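/- Let $G$ be a finite-dimensional real Lie group with Lie algebra $\mathfrak g$, let $\langle\cdot,\cdot\rangle$ be a positive-definite inner product on $\mathfrak g$ that is bi-invariant, i.e. $\langle[u,v],w\rangle+\langle v,[u,w]\rangle=0$ for all $u,v,w\in\mathfrak g$, and let $H$ be a (not necessarily closed) Lie subgroup of $G$ with Lie algebra $\mathfrak h\subseteq\mathfrak g$. Let $P$ be the $\langle\cdot,\cdot\rangle$-orthogonal projection of $\mathfrak g$ onto $\mathfrak h$, let $\delta\in(-1,\infty)$, put $\Lambda=I+\delta P$, and equip $G$ with the left-invariant Riemannian metric defined by the inner product $g(u,v)=\langle u,v\rangle+\delta\langle Pu,Pv\rangle=\langle u,\Lambda v\rangle$ on $\mathfrak g$ (then $G$ with this metric is called a Berger-Cheeger group). For $u,v\in\mathfrak g$ let $\mathrm{ad}^\star_uv\in\mathfrak g$ be defined by $g(\mathrm{ad}^\star_uv,w)=g(v,[u,w])$ for all $w\in\mathfrak g$. Let $\gamma:\mathbb R\to G$ be a geodesic (a smooth curve which on every compact interval is a critical point of the energy $\frac12\int g(\gamma',\gamma')\,dt$ among curves with the same end points) with $\gamma(0)=\mathrm{id}$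 and $\gamma'(0)=u_0$, and suppose that $\gamma$ is nonsteady, i.e. $\mathrm{ad}^\star_{u_0}u_0\neq0$. If $e^{\tau\Lambda u_0}=\mathrm{id}$ for some $\tau>0$, where $v\mapsto e^v$ is the exponential map of the Lie group $G$, then $\gamma(\tau)$ is conjugate to $\gamma(0)$ along $\gamma$: that is, $\gamma(\tau)=\exp(\tau u_0)$, and the differential of $\exp$ at $\tau u_0$ exists and is singular. Here $\exp:\mathfrak g\to G$ is the Riemannian exponential map at the identity, which sends $w\in\mathfrak g$ to $\sigma(1)$, where $\sigma$ and $u:\mathbb R\to\mathfrak g$ solve the geodesic equations $\sigma'(t)=\sigma(t)u(t)$, $u'(t)=\mathrm{ad}^\star_{u(t)}u(t)$ with $\sigma(0)=\mathrm{id}$, $u(0)=w$. -/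

import Mathlib

open scoped Manifold ContDiff

namespace BergerCheeger

noncomputable section

/-! ### Inner products on a real vector space -/

/-- An inner product (symmetric, positive-definite bilinear form) on a real vector space. -/
structure InnerProd (V : Type*) [AddCommGroup V] [Module ℝ V] where
  /-- the underlying bilinear form -/
  form : LinearMap.BilinForm ℝ V
  symm : ∀ u v, form u v = form v u
  pos : ∀ u, u ≠ 0 → 0 < form u u

section InnerProd

variable {V : Type*} [AddCommGroup V] [Module ℝ V]

theorem InnerProd.isRefl (B : InnerProd V) : B.form.IsRefl := by
  intro u v h
  rw [B.symm, h]

theorem InnerProd.nondegenerate (B : InnerProd V) : B.form.Nondegenerate := by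
  refine ⟨fun u hu => ?_, fun u hu => ?_⟩ <;>
  · by_contra h
    exact (B.pos u h).ne' (hu u)

variable [FiniteDimensional ℝ V]

theorem InnerProd.isCompl (B : InnerProd V) (W : Submodule ℝ V) :
    IsCompl W (B.form.orthogonal W) := by
  apply LinearMap.BilinForm.isCompl_orthogonal_of_restrict_nondegenerate B.isRefl
  refine ⟨fun u hu => ?_, fun u hu => ?_⟩ <;>
  · by_contra h
    exact (B.pos u (by simpa using h)).ne' (hu u)

/-- The orthogonal projection of `V` onto `W` with respect to `B`. -/
def InnerProd.proj (B : InnerProd V) (W : Submodule ℝ V) : V →ₗ[ℝ] V :=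
  W.projection (B.form.orthogonal W) (B.isCompl W)

theorem InnerProd.proj_mem (B : InnerProd V) (W : Submodule ℝ V) (u : V) : B.proj W u ∈ W :=
  Submodule.projection_apply_mem _ u

theorem InnerProd.form_sub_proj (B : InnerProd V) (W : Submodule ℝ V) (u w : V) (hw : w ∈ W) :
    B.form w (u - B.proj W u) = 0 := by
  have h : u - B.proj W u ∈ B.form.orthogonal W := by
    rw [InnerProd.proj, ← Submodule.projection_eq_self_sub_projection (B.isCompl W)]
    exact Submodule.projection_apply_mem _ u
  exact (LinearMap.BilinForm.mem_orthogonal_iff.mp h) w hw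

/-- The operator `Λ = I + δ P`, with `P` the orthogonal projection onto `W`. -/
def InnerProd.lam (B : InnerProd V) (W : Submodule ℝ V) (δ : ℝ) : V →ₗ[ℝ] V :=
  LinearMap.id + δ • B.proj W

/-- The deformed inner product `g(u, v) = ⟨u, v⟩ + δ ⟨P u, P v⟩`. -/
def InnerProd.cheeger (B : InnerProd V) (W : Submodule ℝ V) (δ : ℝ) (hδ : -1 < δ) :
    InnerProd V where
  form := B.form + δ • B.form.compl₁₂ (B.proj W) (B.proj W)
  symm u v := by
    simp [B.symm u v, B.symm (B.proj W u) (B.proj W v)]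
  pos u hu := by
    have h0 : ∀ x, 0 ≤ B.form x x := fun x => by
      by_cases hx : x = 0
      · simp [hx]
      · exact (B.pos x hx).le
    have h1 := B.form_sub_proj W u _ (B.proj_mem W u)
    have h2 : B.form u u = B.form (B.proj W u) (B.proj W u)
        + B.form (u - B.proj W u) (u - B.proj W u) := by
      have h3 := B.symm (u - B.proj W u) (B.proj W u)
      simp only [map_sub, LinearMap.sub_apply] at h1 h3 ⊢
      linarith
    have h3 := h0 (B.proj W u)
    have h4 := h0 (u - B.proj W u)
    simp only [LinearMap.add_apply, LinearMap.smul_apply, LinearMap.compl₁₂_apply, smul_eq_mul]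
    by_cases hp : B.proj W u = 0
    · simpa [hp] using B.pos u hu
    · have h5 := B.pos _ hp
      nlinarith

end InnerProd

/-! ### Lie groups with a left-invariant metric -/

section LieGroup

variable {E : Type*} [NormedAddCommGroup E] [NormedSpace ℝ E]
  {G : Type*} [TopologicalSpace G] [ChartedSpace E G] [Group G]

instance [FiniteDimensional ℝ E] : FiniteDimensional ℝ (GroupLieAlgebra 𝓘(ℝ, E) G) :=
  inferInstanceAs (FiniteDimensional ℝ E)

/-- For `x ∈ T_η G`, the Lie algebra element `η⁻¹ x`, i.e. the `u` with `x = η u`. -/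
def leftTranslate (η : G) (x : TangentSpace 𝓘(ℝ, E) η) : GroupLieAlgebra 𝓘(ℝ, E) G :=
  (mfderiv 𝓘(ℝ, E) 𝓘(ℝ, E) (fun a : G => η⁻¹ * a) η x : E)

/-- The left-invariant Riemannian metric on `G` that the inner product `g` on the Lie algebra
defines: `g_η(x, y) = g(u, v)` where `x = η u` and `y = η v`. -/
def leftInvariantMetric (g : InnerProd (GroupLieAlgebra 𝓘(ℝ, E) G)) (η : G)
    (x y : TangentSpace 𝓘(ℝ, E) η) : ℝ :=
  g.form (leftTranslate η x) (leftTranslate η y)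

/-- The tangent vector `γ'(t)`. -/
def velocity (γ : ℝ → G) (t : ℝ) : TangentSpace 𝓘(ℝ, E) (γ t) :=
  mfderiv 𝓘(ℝ, ℝ) 𝓘(ℝ, E) γ t (1 : ℝ)

/-- The energy of `γ` on `[a, b]`, namely `1/2 ∫ g(γ', γ') dt`. -/
def energy (g : InnerProd (GroupLieAlgebra 𝓘(ℝ, E) G)) (a b : ℝ) (γ : ℝ → G) : ℝ :=
  (1 / 2) * ∫ t in a..b, leftInvariantMetric g (γ t) (velocity γ t) (velocity γ t)

/-- `γ` is a geodesic of the left-invariant metric: it is smooth and, on every compact interval,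
a critical point of the energy among curves with the same end points. -/
structure IsGeodesic (g : InnerProd (GroupLieAlgebra 𝓘(ℝ, E) G)) (γ : ℝ → G) : Prop where
  smooth : ContMDiff 𝓘(ℝ, ℝ) 𝓘(ℝ, E) ∞ γ
  critical : ∀ a b : ℝ, a < b → ∀ Γ : ℝ → ℝ → G,
    ContMDiff 𝓘(ℝ, ℝ × ℝ) 𝓘(ℝ, E) ∞ (fun p : ℝ × ℝ => Γ p.1 p.2) →
    (∀ t, Γ 0 t = γ t) → (∀ s, Γ s a = γ a) → (∀ s, Γ s b = γ b) →
    HasDerivAt (fun s => energy g a b (Γ s)) 0 0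

open Classical in
/-- The exponential map of the Lie group: `exp(v) = α(1)`, where `α` is the integral curve through
the identity of the left-invariant vector field defined by `v`. -/
def lieExp (v : GroupLieAlgebra 𝓘(ℝ, E) G) : G :=
  if h : ∃ α : ℝ → G, IsMIntegralCurve (I := 𝓘(ℝ, E)) α (mulInvariantVectorField v) ∧ α 0 = 1
  then h.choose 1 else 1

/-- An inner product on the Lie algebra is bi-invariant if every `ad_u` is skew-symmetric. -/
def IsBiInvariant (B : InnerProd (GroupLieAlgebra 𝓘(ℝ, E) G)) : Prop :=
  ∀ u v w : GroupLieAlgebra 𝓘(ℝ, E) G, B.form ⁅u, v⁆ w + B.form v ⁅u, w⁆ = 0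

variable [LieGroup 𝓘(ℝ, E) ∞ G] [FiniteDimensional ℝ E]

/-- The linear map `ad_u w = [u, w]` on the Lie algebra of `G`. -/
def ad (u : GroupLieAlgebra 𝓘(ℝ, E) G) :
    GroupLieAlgebra 𝓘(ℝ, E) G →ₗ[ℝ] GroupLieAlgebra 𝓘(ℝ, E) G :=
  haveI : LieGroup 𝓘(ℝ, E) (minSmoothness ℝ 3) G := by
    rw [minSmoothness_of_isRCLikeNormedField]; infer_instance
  haveI : CompleteSpace E := FiniteDimensional.complete ℝ E
  { toFun := fun w => ⁅u, w⁆
    map_add' := fun w₁ w₂ => lie_add u w₁ w₂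
    map_smul' := fun c w => lie_smul c u w }

/-- The vector `ad*_u v`, determined by `g(ad*_u v, w) = g(v, ad_u w)` for all `w`. -/
def adStar (g : InnerProd (GroupLieAlgebra 𝓘(ℝ, E) G)) (u v : GroupLieAlgebra 𝓘(ℝ, E) G) :
    GroupLieAlgebra 𝓘(ℝ, E) G :=
  (g.form.toDual g.nondegenerate).symm (g.form v ∘ₗ ad u)

theorem form_adStar (g : InnerProd (GroupLieAlgebra 𝓘(ℝ, E) G))
    (u v w : GroupLieAlgebra 𝓘(ℝ, E) G) :
    g.form (adStar g u v) w = g.form v ⁅u, w⁆ := by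
  rw [adStar, LinearMap.BilinForm.apply_toDual_symm_apply]
  rfl

/-- `(γ, u)` solves the flow equation `γ' = γ u` and the Euler-Arnold equation `u' = ad*_u u`. -/
structure IsEulerArnoldSolution (g : InnerProd (GroupLieAlgebra 𝓘(ℝ, E) G))
    (γ : ℝ → G) (u : ℝ → GroupLieAlgebra 𝓘(ℝ, E) G) : Prop where
  flow : ∀ t, HasMFDerivAt 𝓘(ℝ, ℝ) 𝓘(ℝ, E) γ t
    ((1 : ℝ →L[ℝ] ℝ).smulRight (mulInvariantVectorField (u t) (γ t)))
  euler : ∀ t, HasDerivAt u (adStar g (u t) (u t)) t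

open Classical in
/-- The Riemannian exponential map at the identity: it sends `w` to `γ(1)`, where `(γ, u)` solves
the geodesic equations `γ' = γ u`, `u' = ad*_u u` with `γ(0) = id` and `γ'(0) = w`. -/
def riemannianExp (g : InnerProd (GroupLieAlgebra 𝓘(ℝ, E) G))
    (w : GroupLieAlgebra 𝓘(ℝ, E) G) : G :=
  if h : ∃ (γ : ℝ → G) (u : ℝ → GroupLieAlgebra 𝓘(ℝ, E) G),
      IsEulerArnoldSolution g γ u ∧ γ 0 = 1 ∧ u 0 = w
  then h.choose 1 else 1

/-- For the geodesic `γ` with `γ(0) = id` and `γ'(0) = u₀`: the point `γ(τ)` is conjugate to `γ(0)`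
along `γ`. That is, `γ(τ) = exp(τ u₀)`, and the Riemannian exponential map is differentiable at
`τ u₀` with singular derivative. -/
def IsConjugateAlong (g : InnerProd (GroupLieAlgebra 𝓘(ℝ, E) G)) (γ : ℝ → G)
    (u₀ : GroupLieAlgebra 𝓘(ℝ, E) G) (τ : ℝ) : Prop :=
  γ τ = riemannianExp g (τ • u₀) ∧
  ∃ D, HasMFDerivAt 𝓘(ℝ, E) 𝓘(ℝ, E) (M := E) (riemannianExp g) (τ • u₀ : E) D ∧
    ¬ Function.Injective D

end LieGroup

/-! ### Lie subgroups -/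

section Subgroup

variable {E : Type*} [NormedAddCommGroup E] [NormedSpace ℝ E]
  {G : Type*} [TopologicalSpace G] [ChartedSpace E G] [Group G]
  {F : Type*} [NormedAddCommGroup F] [NormedSpace ℝ F]
  {K : Type*} [TopologicalSpace K] [ChartedSpace F K] [Group K]

variable (E F) in
/-- `ι : K → G` exhibits the Lie group `K` as an (immersed, not necessarily closed) Lie subgroup
of `G`. -/
structure IsLieSubgroup (ι : K →* G) : Prop where
  injective : Function.Injective ι
  smooth : ContMDiff 𝓘(ℝ, F) 𝓘(ℝ, E) ∞ ι
  immersion : ∀ k, Function.Injective (mfderiv 𝓘(ℝ, F) 𝓘(ℝ, E) ι k)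

variable (E F) in
/-- The Lie algebra of the Lie subgroup `ι : K → G`, as a subspace of the Lie algebra of `G`. -/
def subgroupLieAlgebra (ι : K →* G) : Submodule ℝ (GroupLieAlgebra 𝓘(ℝ, E) G) :=
  let L : F →L[ℝ] E := mfderiv 𝓘(ℝ, F) 𝓘(ℝ, E) ι 1
  (LinearMap.range L.toLinearMap : Submodule ℝ E)

end Subgroup

end

end BergerCheeger

/-!
# Conjugate points in Berger-Cheeger groups

Write `𝔥` for the Lie algebra of the subgroup, `P` for the orthogonal projection onto `𝔥`,
`Λ = 1 + δ P`, and `exp` for the exponential map of the Lie group.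

Since `𝔥` is a subalgebra and `ad` is skew, `ad_p` commutes with `P` for `p ∈ 𝔥`
(`InnerProd.proj_bracket`). This gives `ad*_u u = δ [P u, u]` (`adStar_cheeger_self`), so the
Euler-Arnold equation keeps `P u` constant and is linear along each solution. Its solution is
`u(t) = Ad (exp (t δ P w)) w`, and the geodesic with initial velocity `w` is
`γ(t) = exp (t Λ w) exp (t δ P w)⁻¹` (`IsEulerArnoldSolution.eq_cheegerGeodesic`). At `t = 1` this is
a formula for the Riemannian exponential map (`riemannianExp_cheeger`), which is therefore
differentiable because `exp` is (`mdifferentiableAt_lieExp`).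

Let `p = P u₀` and `w_s = Ad (exp (s p)) (τ u₀)`. Then `P w_s = τ p` does not depend on `s`, and
`Λ w_s = Ad (exp (s p)) (τ Λ u₀)`, so `exp (Λ w_s)` is conjugate to `exp (τ Λ u₀) = 1`. Hence the
Riemannian exponential map is constant along `w_s` (`cheegerGeodesic_Ad_lieExp`), and its
differential at `τ u₀` kills the velocity `τ [p, u₀]` of `w_s` at `s = 0`. This vector is nonzero
because `δ [p, u₀] = ad*_{u₀} u₀ ≠ 0`.

Two inputs need proofs from the definitions. The first is that curves critical for the energy solve
the Euler-Arnold equation: `IsGeodesic.integral_eq_zero` uses only the variations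
`γ(t) exp (s f(t) v)`. The second is the calculus on `G`: that `Ad` is smooth with the Lie bracket as
its differential at the identity (`adL_apply`), and that `exp` is defined everywhere and
differentiable. For the last point, `y(t) = exp (t (w + h)) exp (t w)⁻¹` satisfies
`y' = y (Ad (exp (t w)) h)`, and in the chart at the identity `y(1)` is the integral of
`Ad (exp (t w)) h` up to a higher order error in `h` (`exists_norm_chart_sub_le`).

Tangent vectors at the identity are treated as elements of the model space `E`, and the velocity of
a curve `γ` is recorded by the `u ∈ E` with `γ' = γ u` (`HasLeftVelocity`).
-/

namespace BergerCheeger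

noncomputable section

open Filter Topology

/-! ### Translations, the adjoint representation and left velocities of curves -/

section LieGroup

variable {E : Type*} [NormedAddCommGroup E] [NormedSpace ℝ E]
  {G : Type*} [TopologicalSpace G] [ChartedSpace E G] [Group G]

section Translations

variable (E) in
/-- The differential at the identity of left translation by `x`, with both tangent spaces read as
the model space `E`. -/
def dL (x : G) : E →L[ℝ] E := mfderiv 𝓘(ℝ, E) 𝓘(ℝ, E) (fun y : G => x * y) 1

variable (E) in
/-- The adjoint representation: the differential at the identity of `y ↦ x y x⁻¹`. -/
def Ad (x : G) : E →L[ℝ] E := mfderiv 𝓘(ℝ, E) 𝓘(ℝ, E) (fun y : G => x * y * x⁻¹) 1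

/-- The curve `γ` is differentiable at `t` with `γ'(t) = γ(t) u`, where the Lie algebra element `u`
is read in the model space `E`. -/
def HasLeftVelocity (γ : ℝ → G) (u : E) (t : ℝ) : Prop :=
  HasMFDerivAt 𝓘(ℝ, ℝ) 𝓘(ℝ, E) γ t ((1 : ℝ →L[ℝ] ℝ).smulRight (dL E (γ t) u) : ℝ →L[ℝ] E)

lemma dL_one : dL E (1 : G) = ContinuousLinearMap.id ℝ E := by
  have : (fun y : G => 1 * y) = id := by ext; simp
  rw [dL, this]
  exact mfderiv_id

lemma Ad_one : Ad E (1 : G) = ContinuousLinearMap.id ℝ E := by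
  have : (fun y : G => 1 * y * 1⁻¹) = id := by ext; simp
  rw [Ad, this]
  exact mfderiv_id

lemma Ad_one_apply (u : E) : Ad E (1 : G) u = u := by
  rw [Ad_one]; rfl

variable [LieGroup 𝓘(ℝ, E) ∞ G]

lemma hasMFDerivAt_mul_left (x y : G) : HasMFDerivAt 𝓘(ℝ, E) 𝓘(ℝ, E) (fun z : G => x * z) y
    (mfderiv 𝓘(ℝ, E) 𝓘(ℝ, E) (fun z : G => x * z) y) :=
  ((contMDiff_mul_left (n := ∞)).mdifferentiableAt (by simp)).hasMFDerivAt

lemma hasMFDerivAt_mul_right (x y : G) : HasMFDerivAt 𝓘(ℝ, E) 𝓘(ℝ, E) (fun z : G => z * x) y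
    (mfderiv 𝓘(ℝ, E) 𝓘(ℝ, E) (fun z : G => z * x) y) :=
  ((contMDiff_mul_right (n := ∞)).mdifferentiableAt (by simp)).hasMFDerivAt

lemma hasMFDerivAt_dL (x : G) :
    HasMFDerivAt 𝓘(ℝ, E) 𝓘(ℝ, E) (fun z : G => x * z) 1 (dL E x) :=
  hasMFDerivAt_mul_left x 1

lemma hasMFDerivAt_Ad (x : G) :
    HasMFDerivAt 𝓘(ℝ, E) 𝓘(ℝ, E) (fun z : G => x * z * x⁻¹) 1 (Ad E x) := by
  have : ContMDiff 𝓘(ℝ, E) 𝓘(ℝ, E) ∞ (fun z : G => x * z * x⁻¹) :=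
    contMDiff_mul_left.mul contMDiff_const
  exact (this.mdifferentiableAt (by simp)).hasMFDerivAt

/-- Left translation by `x` carries `y u` to `x y u`. -/
lemma mfderiv_mul_left_dL (x y : G) (u : E) :
    (mfderiv 𝓘(ℝ, E) 𝓘(ℝ, E) (fun z : G => x * z) y : E →L[ℝ] E) (dL E y u) =
      dL E (x * y) u := by
  have h2 : HasMFDerivAt 𝓘(ℝ, E) 𝓘(ℝ, E) (fun z : G => x * z) (y * 1)
      (mfderiv 𝓘(ℝ, E) 𝓘(ℝ, E) (fun z : G => x * z) y) := by
    have := hasMFDerivAt_mul_left (E := E) x y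
    rw [mul_one]
    exact this
  have h3 := h2.comp 1 (hasMFDerivAt_dL (E := E) y)
  have h4 : (fun z : G => x * z) ∘ (fun z : G => y * z) = fun z => x * y * z := by
    ext; simp [mul_assoc]
  rw [h4] at h3
  exact congrArg (fun L : E →L[ℝ] E => L u) (hasMFDerivAt_unique h3 (hasMFDerivAt_dL (x * y)))

/-- Right translation by `y` carries `x u` to `x y (Ad y⁻¹ u)`. -/
lemma mfderiv_mul_right_dL (x y : G) (u : E) :
    (mfderiv 𝓘(ℝ, E) 𝓘(ℝ, E) (fun z : G => z * y) x : E →L[ℝ] E) (dL E x u) =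
      dL E (x * y) (Ad E y⁻¹ u) := by
  have h1 : HasMFDerivAt 𝓘(ℝ, E) 𝓘(ℝ, E) (fun z : G => z * y) (x * 1)
      (mfderiv 𝓘(ℝ, E) 𝓘(ℝ, E) (fun z : G => z * y) x) := by
    have := hasMFDerivAt_mul_right (E := E) y x
    rw [mul_one]
    exact this
  have h2 : HasMFDerivAt 𝓘(ℝ, E) 𝓘(ℝ, E) (fun z : G => x * y * z) (y⁻¹ * 1 * y⁻¹⁻¹)
      (dL E (x * y)) := by
    have := hasMFDerivAt_dL (E := E) (x * y)
    rw [mul_one, mul_inv_cancel]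
    exact this
  have h3 := h1.comp 1 (hasMFDerivAt_dL (E := E) x)
  have h4 := h2.comp 1 (hasMFDerivAt_Ad (E := E) y⁻¹)
  have h5 : (fun z : G => x * y * z) ∘ (fun z : G => y⁻¹ * z * y⁻¹⁻¹) =
      (fun z : G => z * y) ∘ (fun z : G => x * z) := by
    ext; simp [mul_assoc]
  rw [h5] at h4
  exact congrArg (fun L : E →L[ℝ] E => L u) (hasMFDerivAt_unique h3 h4)

lemma leftTranslate_dL (x : G) (u : E) : leftTranslate x (dL E x u) = u := by
  have h := mfderiv_mul_left_dL (E := E) x⁻¹ x u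
  rw [inv_mul_cancel, dL_one] at h
  exact h

lemma dL_injective (x : G) : Function.Injective (dL E x) := fun u v h => by
  rw [← leftTranslate_dL x u, h, leftTranslate_dL]

lemma exists_dL_eq (x : G) (v : E) : ∃ u, dL E x u = v := by
  refine ⟨leftTranslate x v, ?_⟩
  have h1 : HasMFDerivAt 𝓘(ℝ, E) 𝓘(ℝ, E) (fun z : G => x * z) (x⁻¹ * x) (dL E x) := by
    have := hasMFDerivAt_dL (E := E) x
    rw [inv_mul_cancel]
    exact this
  have h3 := h1.comp x (hasMFDerivAt_mul_left x⁻¹ x)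
  have h4 : (fun z : G => x * z) ∘ (fun z : G => x⁻¹ * z) = id := by
    ext; simp
  rw [h4] at h3
  exact congrArg (fun L : E →L[ℝ] E => L v) (hasMFDerivAt_unique h3 (hasMFDerivAt_id x))

lemma Ad_mul (x y : G) : Ad E (x * y) = (Ad E x).comp (Ad E y) := by
  have h2 : HasMFDerivAt 𝓘(ℝ, E) 𝓘(ℝ, E) (fun z : G => x * z * x⁻¹) (y * 1 * y⁻¹) (Ad E x) := by
    have := hasMFDerivAt_Ad (E := E) x
    rw [mul_one, mul_inv_cancel]
    exact this
  have h3 := h2.comp 1 (hasMFDerivAt_Ad (E := E) y)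
  have h4 : (fun z : G => x * z * x⁻¹) ∘ (fun z : G => y * z * y⁻¹) =
      fun z => x * y * z * (x * y)⁻¹ := by
    ext; simp [mul_assoc]
  rw [h4] at h3
  exact hasMFDerivAt_unique (hasMFDerivAt_Ad (x * y)) h3

lemma Ad_mul_apply (x y : G) (u : E) : Ad E (x * y) u = Ad E x (Ad E y u) := by
  rw [Ad_mul]; rfl

lemma Ad_Ad_inv (x : G) (u : E) : Ad E x (Ad E x⁻¹ u) = u := by
  rw [← Ad_mul_apply, mul_inv_cancel, Ad_one_apply]

end Translations

section LeftVelocity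

lemma HasLeftVelocity.unique {γ : ℝ → G} {u v : E} {t : ℝ} [LieGroup 𝓘(ℝ, E) ∞ G]
    (hu : HasLeftVelocity γ u t) (hv : HasLeftVelocity γ v t) : u = v := by
  have h : ((1 : ℝ →L[ℝ] ℝ).smulRight (dL E (γ t) u) : ℝ →L[ℝ] E) =
    (1 : ℝ →L[ℝ] ℝ).smulRight (dL E (γ t) v) := hasMFDerivAt_unique hu hv
  refine dL_injective (γ t) ?_
  simpa using congrArg (fun L : ℝ →L[ℝ] E => L 1) h

lemma HasLeftVelocity.continuousAt {γ : ℝ → G} {u : E} {t : ℝ} (hu : HasLeftVelocity γ u t) :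
    ContinuousAt γ t :=
  HasMFDerivAt.continuousAt hu

lemma hasLeftVelocity_of_hasMFDerivAt {γ : ℝ → G} {L : ℝ →L[ℝ] E} {t : ℝ} {u : E}
    (h : HasMFDerivAt 𝓘(ℝ, ℝ) 𝓘(ℝ, E) γ t L) (hL : L 1 = dL E (γ t) u) :
    HasLeftVelocity γ u t := by
  have : L = (1 : ℝ →L[ℝ] ℝ).smulRight (dL E (γ t) u) := by
    ext; simp [hL]
  subst this
  exact h

lemma HasLeftVelocity.velocity {γ : ℝ → G} {u : E} {t : ℝ} (h : HasLeftVelocity γ u t) :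
    velocity γ t = dL E (γ t) u := by
  have := HasMFDerivAt.mfderiv h
  rw [BergerCheeger.velocity, this]
  exact one_smul ℝ (dL E (γ t) u)

lemma hasLeftVelocity_const (x : G) (t : ℝ) : HasLeftVelocity (fun _ => x) (0 : E) t :=
  hasLeftVelocity_of_hasMFDerivAt (L := 0) (hasMFDerivAt_const x t) (by simp)

lemma HasLeftVelocity.comp {α : ℝ → G} {f : ℝ → ℝ} {a : E} {f' t : ℝ}
    (ha : HasLeftVelocity α a (f t)) (hf : HasDerivAt f f' t) :
    HasLeftVelocity (fun s => α (f s)) (f' • a) t := by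
  have h := HasMFDerivAt.comp t ha hf.hasFDerivAt.hasMFDerivAt
  refine hasLeftVelocity_of_hasMFDerivAt h ?_
  rw [map_smul]
  show ((1 : ℝ) • f') • dL E (α (f t)) a = _
  simp

variable [LieGroup 𝓘(ℝ, E) ∞ G]

lemma exists_hasLeftVelocity {γ : ℝ → G} {t : ℝ}
    (h : MDifferentiableAt 𝓘(ℝ, ℝ) 𝓘(ℝ, E) γ t) : ∃ u : E, HasLeftVelocity γ u t := by
  obtain ⟨u, hu⟩ := exists_dL_eq (E := E) (γ t)
    ((mfderiv 𝓘(ℝ, ℝ) 𝓘(ℝ, E) γ t : ℝ →L[ℝ] E) 1)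
  exact ⟨u, hasLeftVelocity_of_hasMFDerivAt h.hasMFDerivAt hu.symm⟩

lemma HasLeftVelocity.leftTranslate_velocity {γ : ℝ → G} {u : E} {t : ℝ}
    (h : HasLeftVelocity γ u t) :
    leftTranslate (γ t) (BergerCheeger.velocity (E := E) γ t) = u := by
  rw [h.velocity, leftTranslate_dL]

lemma HasLeftVelocity.mul {α β : ℝ → G} {a b : E} {t : ℝ}
    (ha : HasLeftVelocity α a t) (hb : HasLeftVelocity β b t) :
    HasLeftVelocity (fun s => α s * β s) (Ad E (β t)⁻¹ a + b) t := by
  have hm : MDifferentiableAt (𝓘(ℝ, E).prod 𝓘(ℝ, E)) 𝓘(ℝ, E) (fun p : G × G => p.1 * p.2)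
      (α t, β t) := (contMDiff_mul 𝓘(ℝ, E) ∞).mdifferentiableAt (by simp)
  have h := hm.hasMFDerivAt.comp t (HasMFDerivAt.prodMk ha hb)
  refine hasLeftVelocity_of_hasMFDerivAt h ?_
  have h2 := mfderiv_prod_eq_add_apply (v := (dL E (α t) a, dL E (β t) b)) hm
  have h3 := mfderiv_mul_left_dL (α t) (β t) b
  have h4 := mfderiv_mul_right_dL (α t) (β t) a
  rw [map_add, ← h4, ← h3]
  refine Eq.trans ?_ h2
  show (mfderiv (𝓘(ℝ, E).prod 𝓘(ℝ, E)) 𝓘(ℝ, E) (fun p : G × G => p.1 * p.2)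
      (α t, β t) : E × E →L[ℝ] E) ((1 : ℝ) • dL E (α t) a, (1 : ℝ) • dL E (β t) b) = _
  rw [one_smul, one_smul]

lemma HasLeftVelocity.inv {α : ℝ → G} {a : E} {t : ℝ} (ha : HasLeftVelocity α a t) :
    HasLeftVelocity (fun s => (α s)⁻¹) (-Ad E (α t) a) t := by
  have hm : MDifferentiableAt 𝓘(ℝ, E) 𝓘(ℝ, E) (fun p : G => p⁻¹)
      (α t) := (contMDiff_inv 𝓘(ℝ, E) ∞).mdifferentiableAt (by simp)
  obtain ⟨c, hc⟩ := exists_hasLeftVelocity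
    (hm.comp t (HasMFDerivAt.mdifferentiableAt ha))
  have h := ha.mul hc
  simp only [Function.comp_apply, mul_inv_cancel, inv_inv] at h
  have h2 := h.unique (hasLeftVelocity_const 1 t)
  rw [neg_eq_of_add_eq_zero_right h2]
  exact hc

lemma HasLeftVelocity.mul_left {α : ℝ → G} {a : E} {t : ℝ} (x : G)
    (ha : HasLeftVelocity α a t) : HasLeftVelocity (fun s => x * α s) a t := by
  simpa using (hasLeftVelocity_const x t).mul ha

lemma HasLeftVelocity.mul_right {α : ℝ → G} {a : E} {t : ℝ} (x : G)
    (ha : HasLeftVelocity α a t) : HasLeftVelocity (fun s => α s * x) (Ad E x⁻¹ a) t := by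
  simpa using ha.mul (hasLeftVelocity_const x t)

variable [FiniteDimensional ℝ E] [T2Space G]

/-- A curve with vanishing velocity is an integral curve of the zero vector field, hence
constant. -/
lemma eq_of_hasLeftVelocity_zero {α : ℝ → G} (h : ∀ t, HasLeftVelocity α (0 : E) t) (t s : ℝ) :
    α t = α s := by
  have : IsManifold 𝓘(ℝ, E) 1 G := IsManifold.of_le (n := ∞) (by simp)
  have : CompleteSpace E := FiniteDimensional.complete ℝ E
  let V : (x : G) → TangentSpace 𝓘(ℝ, E) x := fun x => (0 : E)
  have hV : ContMDiff 𝓘(ℝ, E) 𝓘(ℝ, E).tangent 1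
      (fun x => (⟨x, V x⟩ : TangentBundle 𝓘(ℝ, E) G)) := Bundle.contMDiff_zeroSection ℝ _
  have h1 : IsMIntegralCurve (I := 𝓘(ℝ, E)) α V := fun t => by
    have := h t
    rw [HasLeftVelocity, map_zero] at this
    exact this
  have h2 := isMIntegralCurve_Ioo_eq_of_contMDiff_boundaryless (t₀ := s) hV h1
    (isMIntegralCurve_const (x := α s) rfl) rfl
  exact congrFun h2 t

/-- A curve in `G` is determined by its left velocity and its initial value. -/
lemma eq_of_hasLeftVelocity {α β : ℝ → G} {u : ℝ → E} (hα : ∀ t, HasLeftVelocity α (u t) t)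
    (hβ : ∀ t, HasLeftVelocity β (u t) t) (h0 : α 0 = β 0) : α = β := by
  have h : ∀ t, HasLeftVelocity (fun s => α s * (β s)⁻¹) (0 : E) t := fun t => by
    simpa using (hα t).mul (hβ t).inv
  ext t
  have := eq_of_hasLeftVelocity_zero h t 0
  rwa [h0, mul_inv_cancel, mul_inv_eq_one] at this

end LeftVelocity

/-! ### The differential of the adjoint representation is the Lie bracket -/

lemma chart_one_symm_apply : (extChartAt 𝓘(ℝ, E) (1 : G)).symm (extChartAt 𝓘(ℝ, E) (1 : G) 1) = 1 :=
  by simp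

variable [LieGroup 𝓘(ℝ, E) ∞ G]

section Smoothness

instance : IsManifold 𝓘(ℝ, E) 1 G := IsManifold.of_le (n := ∞) (by simp)

/-- The differential at `g x` of a smooth family `f x` with `f x (g x) = 1` depends smoothly
on `x`, since it takes values in the fixed space `T₁G`. -/
lemma contMDiffAt_mfderiv_of_apply_eq_one
    {N : Type*} {E' : Type*} [NormedAddCommGroup E'] [NormedSpace ℝ E'] [TopologicalSpace N]
    [ChartedSpace E' N] [IsManifold 𝓘(ℝ, E') ∞ N]
    {V : Type*} [NormedAddCommGroup V] [NormedSpace ℝ V]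
    {f : N → V → G} {g : N → V} {x₀ : N} {L : N → V →L[ℝ] E}
    (hf : ContMDiffAt (𝓘(ℝ, E').prod 𝓘(ℝ, V)) 𝓘(ℝ, E) ∞ (Function.uncurry f) (x₀, g x₀))
    (hg : ContMDiffAt 𝓘(ℝ, E') 𝓘(ℝ, V) ∞ g x₀) (h1 : ∀ x, f x (g x) = 1)
    (hL : ∀ x, HasMFDerivAt 𝓘(ℝ, V) 𝓘(ℝ, E) (f x) (g x) (L x)) :
    ContMDiffAt 𝓘(ℝ, E') 𝓘(ℝ, V →L[ℝ] E) ∞ L x₀ := by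
  have hL' : L = fun x => mfderiv 𝓘(ℝ, V) 𝓘(ℝ, E) (f x) (g x) :=
    funext fun x => (hL x).mfderiv.symm
  have h : ContMDiffAt 𝓘(ℝ, E') 𝓘(ℝ, V →L[ℝ] E) ∞
      (inTangentCoordinates 𝓘(ℝ, V) 𝓘(ℝ, E) g (fun x => f x (g x)) L x₀) x₀ := by
    rw [hL']
    exact ContMDiffAt.mfderiv f g hf hg (m := ∞) (n := ∞) le_rfl
  refine h.congr_of_eventuallyEq (Eventually.of_forall fun x => ?_)
  have hx : g x ∈ (chartAt V (g x₀)).source := Set.mem_univ _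
  have hy : f x (g x) ∈ (chartAt E (f x₀ (g x₀))).source := by rw [h1, h1]; simp
  rw [inTangentCoordinates_eq (I := 𝓘(ℝ, V)) (I' := 𝓘(ℝ, E)) g (fun x => f x (g x)) _ hx hy]
  rw [TangentBundle.coordChange_model_space, h1, h1]
  ext v
  exact ((tangentBundleCore 𝓘(ℝ, E) G).coordChange_self (achart E 1) 1
    (mem_chart_source E 1) _).symm

lemma hasMFDerivAt_chart_one : HasMFDerivAt 𝓘(ℝ, E) 𝓘(ℝ, E) (extChartAt 𝓘(ℝ, E) (1 : G)) 1
    (ContinuousLinearMap.id ℝ E) := by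
  have h := (mdifferentiableAt_extChartAt (I := 𝓘(ℝ, E)) (mem_chart_source E (1 : G))).hasMFDerivAt
  exact h.congr_mfderiv mfderiv_extChartAt_self

lemma contMDiffAt_chart_one_symm : ContMDiffAt 𝓘(ℝ, E) 𝓘(ℝ, E) ∞ (extChartAt 𝓘(ℝ, E) (1 : G)).symm
    (extChartAt 𝓘(ℝ, E) (1 : G) 1) :=
  (contMDiffOn_extChartAt_symm (1 : G)).contMDiffAt (extChartAt_target_mem_nhds 1)

lemma hasMFDerivAt_chart_one_symm : HasMFDerivAt 𝓘(ℝ, E) 𝓘(ℝ, E)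
    (extChartAt 𝓘(ℝ, E) (1 : G)).symm (extChartAt 𝓘(ℝ, E) (1 : G) 1)
    (ContinuousLinearMap.id ℝ E) := by
  have h := ((contMDiffAt_chart_one_symm (G := G) (E := E)).mdifferentiableAt
    (by simp)).hasMFDerivAt
  refine h.congr_mfderiv ?_
  have := mfderivWithin_range_extChartAt_symm (I := 𝓘(ℝ, E)) (x := (1 : G))
  simp only [modelWithCornersSelf_coe, Set.range_id, mfderivWithin_univ] at this
  exact this

/-- The adjoint representation is smooth: parametrize the variable in which `y ↦ x y x⁻¹` is
differentiated by the chart at the identity. -/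
lemma contMDiff_Ad : ContMDiff 𝓘(ℝ, E) 𝓘(ℝ, E →L[ℝ] E) ∞ (Ad E : G → E →L[ℝ] E) := by
  intro x₀
  set φ := extChartAt 𝓘(ℝ, E) (1 : G) with hφd
  have h1 : φ.symm (φ 1) = 1 := chart_one_symm_apply
  have h2 : ContMDiffAt (𝓘(ℝ, E).prod 𝓘(ℝ, E)) 𝓘(ℝ, E) ∞
      (fun p : G × E => φ.symm p.2) (x₀, φ 1) :=
    ContMDiffAt.comp (x₀, φ 1) contMDiffAt_chart_one_symm contMDiffAt_snd
  refine contMDiffAt_mfderiv_of_apply_eq_one (f := fun (x : G) (v : E) => x * φ.symm v * x⁻¹)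
    (g := fun _ => φ 1) ((contMDiffAt_fst.mul h2).mul contMDiffAt_fst.inv) contMDiffAt_const
    (fun x => by rw [h1, mul_one, mul_inv_cancel]) fun x => ?_
  have h3 : HasMFDerivAt 𝓘(ℝ, E) 𝓘(ℝ, E) (fun z : G => x * z * x⁻¹) (φ.symm (φ 1)) (Ad E x) := by
    rw [h1]
    exact hasMFDerivAt_Ad x
  exact h3.comp (φ 1) hasMFDerivAt_chart_one_symm

end Smoothness

section Bracket

/-- Multiplication read in the chart at the identity. It is meaningful near the image of `(1, 1)`
only, where the arguments and the product stay in the domain of the chart. -/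
def chartMul (G : Type*) [TopologicalSpace G] [ChartedSpace E G] [Group G] (p : E × E) : E :=
  extChartAt 𝓘(ℝ, E) (1 : G)
    ((extChartAt 𝓘(ℝ, E) (1 : G)).symm p.1 * (extChartAt 𝓘(ℝ, E) (1 : G)).symm p.2)

lemma contDiffAt_chartMul :
    ContDiffAt ℝ ∞ (chartMul G) (extChartAt 𝓘(ℝ, E) (1 : G) 1, extChartAt 𝓘(ℝ, E) (1 : G) 1) := by
  rw [← contMDiffAt_iff_contDiffAt]
  set φ := extChartAt 𝓘(ℝ, E) (1 : G) with hφd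
  have hφ : ContMDiffAt 𝓘(ℝ, E) 𝓘(ℝ, E) ∞ φ.symm (φ 1) := contMDiffAt_chart_one_symm
  have h1 : ContMDiffAt 𝓘(ℝ, E × E) 𝓘(ℝ, E) ∞ (fun p : E × E => φ.symm p.1) (φ 1, φ 1) :=
    ContMDiffAt.comp (φ 1, φ 1) hφ contDiff_fst.contMDiff.contMDiffAt
  have h2 : ContMDiffAt 𝓘(ℝ, E × E) 𝓘(ℝ, E) ∞ (fun p : E × E => φ.symm p.2) (φ 1, φ 1) :=
    ContMDiffAt.comp (φ 1, φ 1) hφ contDiff_snd.contMDiff.contMDiffAt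
  have h3 : ContMDiffAt 𝓘(ℝ, E) 𝓘(ℝ, E) ∞ φ (φ.symm (φ 1) * φ.symm (φ 1)) := by
    rw [hφd, chart_one_symm_apply, mul_one]
    exact contMDiffAt_extChartAt
  exact ContMDiffAt.comp (φ 1, φ 1) h3 (h1.mul h2)

lemma eventually_differentiableAt_chartMul : ∀ᶠ p in 𝓝 (extChartAt 𝓘(ℝ, E) (1 : G) 1,
    extChartAt 𝓘(ℝ, E) (1 : G) 1), DifferentiableAt ℝ (chartMul (E := E) G) p := by
  have h := (contDiffAt_chartMul (E := E) (G := G)).of_le (m := 1) (by simp)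
  filter_upwards [h.eventually (by simp)] with p hp
  exact hp.differentiableAt (by simp)

/-- The left-invariant vector field of `q` in the chart at the identity. -/
lemma fderiv_chartMul_inr {z : E} {L : E →L[ℝ] E}
    (hL : HasMFDerivAt 𝓘(ℝ, E) 𝓘(ℝ, E) (extChartAt 𝓘(ℝ, E) (1 : G))
      ((extChartAt 𝓘(ℝ, E) (1 : G)).symm z) L)
    (hd : DifferentiableAt ℝ (chartMul (E := E) G) (z, extChartAt 𝓘(ℝ, E) (1 : G) 1)) (q : E) :
    fderiv ℝ (chartMul (E := E) G) (z, extChartAt 𝓘(ℝ, E) (1 : G) 1) (0, q) =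
      L (dL E ((extChartAt 𝓘(ℝ, E) (1 : G)).symm z) q) := by
  set φ := extChartAt 𝓘(ℝ, E) (1 : G) with hφd
  have h1 : HasFDerivAt (fun y => chartMul (E := E) G (z, y))
      ((fderiv ℝ (chartMul (E := E) G) (z, φ 1)).comp (ContinuousLinearMap.inr ℝ E E)) (φ 1) :=
    hd.hasFDerivAt.comp (φ 1) (hasFDerivAt_prodMk_right z (φ 1))
  have h2 : HasMFDerivAt 𝓘(ℝ, E) 𝓘(ℝ, E) φ (φ.symm z * φ.symm (φ 1)) L := by
    rw [hφd, chart_one_symm_apply, mul_one]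
    exact hL
  have h3 : HasMFDerivAt 𝓘(ℝ, E) 𝓘(ℝ, E) (fun y => φ.symm z * y) (φ.symm (φ 1))
      (dL E (φ.symm z)) := by
    rw [hφd, chart_one_symm_apply]
    exact hasMFDerivAt_dL _
  have h4 := h2.comp (φ 1) (h3.comp (φ 1) hasMFDerivAt_chart_one_symm)
  have h5 := hasMFDerivAt_unique h1.hasMFDerivAt h4
  exact congrArg (fun L : E →L[ℝ] E => L q) h5

/-- The identity `x y = (x y x⁻¹) x`, differentiated in `y` at the identity and read in the
chart. -/
lemma eventually_fderiv_chartMul_inr_eq_inl :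
    ∀ᶠ z in 𝓝 (extChartAt 𝓘(ℝ, E) (1 : G) 1), ∀ q : E,
    fderiv ℝ (chartMul (E := E) G) (z, extChartAt 𝓘(ℝ, E) (1 : G) 1) (0, q) =
      fderiv ℝ (chartMul (E := E) G) (extChartAt 𝓘(ℝ, E) (1 : G) 1, z)
        (Ad E ((extChartAt 𝓘(ℝ, E) (1 : G)).symm z) q, 0) := by
  set φ := extChartAt 𝓘(ℝ, E) (1 : G) with hφd
  have hev := eventually_differentiableAt_chartMul (E := E) (G := G)
  have c1 : Tendsto (fun z : E => (z, φ 1)) (𝓝 (φ 1)) (𝓝 (φ 1, φ 1)) :=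
    (by fun_prop : Continuous fun z : E => (z, φ 1)).continuousAt
  have c2 : Tendsto (fun z : E => (φ 1, z)) (𝓝 (φ 1)) (𝓝 (φ 1, φ 1)) :=
    (by fun_prop : Continuous fun z : E => (φ 1, z)).continuousAt
  filter_upwards [c1.eventually hev, c2.eventually hev] with z hd1 hd2 q
  have hone : φ.symm (φ 1) = 1 := chart_one_symm_apply
  have h1 : HasFDerivAt (fun y => chartMul (E := E) G (z, y))
      ((fderiv ℝ (chartMul (E := E) G) (z, φ 1)).comp (ContinuousLinearMap.inr ℝ E E)) (φ 1) :=
    hd1.hasFDerivAt.comp (φ 1) (hasFDerivAt_prodMk_right z (φ 1))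
  have hconj : φ.symm z * φ.symm (φ 1) * (φ.symm z)⁻¹ = 1 := by rw [hone]; simp
  have hC : HasFDerivAt (fun y => φ (φ.symm z * φ.symm y * (φ.symm z)⁻¹)) (Ad E (φ.symm z))
      (φ 1) := by
    have h2 : HasMFDerivAt 𝓘(ℝ, E) 𝓘(ℝ, E) φ (φ.symm z * φ.symm (φ 1) * (φ.symm z)⁻¹)
        (ContinuousLinearMap.id ℝ E) := by
      rw [hconj]
      exact hasMFDerivAt_chart_one
    have h3 : HasMFDerivAt 𝓘(ℝ, E) 𝓘(ℝ, E) (fun y => φ.symm z * y * (φ.symm z)⁻¹)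
        (φ.symm (φ 1)) (Ad E (φ.symm z)) := by
      rw [hone]
      exact hasMFDerivAt_Ad _
    exact (h2.comp (φ 1) (h3.comp (φ 1) hasMFDerivAt_chart_one_symm)).hasFDerivAt
  have h6 : HasFDerivAt (chartMul (E := E) G)
      (fderiv ℝ (chartMul (E := E) G) (φ 1, z))
      (φ (φ.symm z * φ.symm (φ 1) * (φ.symm z)⁻¹), z) := by
    rw [hconj]
    exact hd2.hasFDerivAt
  have h7 := h6.comp (φ 1) (hC.prodMk (hasFDerivAt_const z (φ 1)))
  have h8 : (fun y => chartMul (E := E) G (z, y)) =ᶠ[𝓝 (φ 1)]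
      (chartMul (E := E) G ∘ fun y => (φ (φ.symm z * φ.symm y * (φ.symm z)⁻¹), z)) := by
    have hT : IsTopologicalGroup G := topologicalGroup_of_lieGroup 𝓘(ℝ, E) ∞
    have hc : ContinuousAt (fun y => φ.symm z * φ.symm y * (φ.symm z)⁻¹) (φ 1) :=
      (continuousAt_const.mul contMDiffAt_chart_one_symm.continuousAt).mul continuousAt_const
    have hs : φ.source ∈ 𝓝 (φ.symm z * φ.symm (φ 1) * (φ.symm z)⁻¹) := by
      rw [hconj]
      exact extChartAt_source_mem_nhds _
    filter_upwards [hc hs] with y hy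
    simp only [chartMul, Function.comp_apply, ← hφd]
    rw [φ.left_inv hy]
    simp
  have h9 := h1.unique (h7.congr_of_eventuallyEq h8)
  exact congrArg (fun L : E →L[ℝ] E => L q) h9

lemma fderiv_chartMul_one_inl (v : E) :
    fderiv ℝ (chartMul (E := E) G)
      (extChartAt 𝓘(ℝ, E) (1 : G) 1, extChartAt 𝓘(ℝ, E) (1 : G) 1) (v, 0) = v := by
  set φ := extChartAt 𝓘(ℝ, E) (1 : G) with hφd
  have hd := (eventually_differentiableAt_chartMul (E := E) (G := G)).self_of_nhds
  have h1 : HasFDerivAt (fun y => chartMul (E := E) G (y, φ 1))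
      ((fderiv ℝ (chartMul (E := E) G) (φ 1, φ 1)).comp (ContinuousLinearMap.inl ℝ E E)) (φ 1) :=
    HasFDerivAt.comp (f := fun y : E => (y, φ 1)) (φ 1) hd.hasFDerivAt
      (hasFDerivAt_prodMk_left (φ 1) (φ 1))
  have h2 : (fun y => chartMul (E := E) G (y, φ 1)) =ᶠ[𝓝 (φ 1)] id := by
    filter_upwards [extChartAt_target_mem_nhds (I := 𝓘(ℝ, E)) (1 : G)] with y hy
    simp only [chartMul, ← hφd]
    rw [hφd, chart_one_symm_apply, mul_one]
    exact φ.right_inv hy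
  have h3 := h1.unique ((hasFDerivAt_id (φ 1)).congr_of_eventuallyEq h2)
  exact congrArg (fun L : E →L[ℝ] E => L v) h3

lemma fderiv_chartMul_one_inr (v : E) :
    fderiv ℝ (chartMul (E := E) G)
      (extChartAt 𝓘(ℝ, E) (1 : G) 1, extChartAt 𝓘(ℝ, E) (1 : G) 1) (0, v) = v := by
  have h := (eventually_fderiv_chartMul_inr_eq_inl (E := E) (G := G)).self_of_nhds v
  rwa [chart_one_symm_apply, Ad_one_apply, fderiv_chartMul_one_inl] at h

/-- The Lie bracket is the antisymmetric part of the mixed second derivative of the multiplication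
at the identity, since `fderiv_chartMul_inr` expresses the left-invariant vector fields by the
first derivative. -/
lemma bracket_eq_fderiv_fderiv_chartMul (p q : GroupLieAlgebra 𝓘(ℝ, E) G) :
    (⁅p, q⁆ : GroupLieAlgebra 𝓘(ℝ, E) G) =
      (fderiv ℝ (fderiv ℝ (chartMul (E := E) G))
        (extChartAt 𝓘(ℝ, E) (1 : G) 1, extChartAt 𝓘(ℝ, E) (1 : G) 1) (p, 0) (0, q) -
      fderiv ℝ (fderiv ℝ (chartMul (E := E) G))
        (extChartAt 𝓘(ℝ, E) (1 : G) 1, extChartAt 𝓘(ℝ, E) (1 : G) 1) (q, 0) (0, p) : E) := by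
  set φ := extChartAt 𝓘(ℝ, E) (1 : G) with hφd
  let W : E → E → E := fun q z => fderiv ℝ (chartMul (E := E) G) (z, φ 1) (0, q)
  have hev := eventually_differentiableAt_chartMul (E := E) (G := G)
  have c1 : Tendsto (fun z : E => (z, φ 1)) (𝓝 (φ 1)) (𝓝 (φ 1, φ 1)) :=
    (by fun_prop : Continuous fun z : E => (z, φ 1)).continuousAt
  have hW : ∀ q : E, (VectorField.mpullbackWithin 𝓘(ℝ, E) 𝓘(ℝ, E) φ.symm
      (mulInvariantVectorField (I := 𝓘(ℝ, E)) (G := G) q) (Set.range 𝓘(ℝ, E)) : E → E)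
      =ᶠ[𝓝 (φ 1)] W q := by
    intro q
    filter_upwards [extChartAt_target_mem_nhds (I := 𝓘(ℝ, E)) (1 : G), c1.eventually hev]
      with z hz hd
    have hz' : φ.symm z ∈ (chartAt E (1 : G)).source := by
      have := φ.map_target hz
      rwa [hφd, extChartAt_source] at this
    have h := fderiv_chartMul_inr (G := G)
      (mdifferentiableAt_extChartAt (I := 𝓘(ℝ, E)) hz').hasMFDerivAt hd q
    have h1 := mfderivWithin_extChartAt_symm_comp_mfderiv_extChartAt (I := 𝓘(ℝ, E)) hz
    have h2 := mfderiv_extChartAt_comp_mfderivWithin_extChartAt_symm (I := 𝓘(ℝ, E)) hz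
    rw [VectorField.mpullbackWithin_apply, ContinuousLinearMap.inverse_eq h1 h2]
    exact h.symm
  have hdW : ∀ p q : E, fderiv ℝ (W q) (φ 1) p =
      fderiv ℝ (fderiv ℝ (chartMul (E := E) G)) (φ 1, φ 1) (p, 0) (0, q) := by
    intro p q
    have h1 : ContDiffAt ℝ 1 (fderiv ℝ (chartMul (E := E) G)) (φ 1, φ 1) :=
      (contDiffAt_chartMul (E := E) (G := G)).fderiv_right (m := 1) (n := ∞) (by norm_cast)
    have h2 : HasFDerivAt (fun z => fderiv ℝ (chartMul (E := E) G) (z, φ 1))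
      ((fderiv ℝ (fderiv ℝ (chartMul (E := E) G)) (φ 1, φ 1)).comp
        (ContinuousLinearMap.inl ℝ E E)) (φ 1) :=
      HasFDerivAt.comp (f := fun y : E => (y, φ 1)) (φ 1)
        (h1.differentiableAt (by simp)).hasFDerivAt (hasFDerivAt_prodMk_left (φ 1) (φ 1))
    have h3 := h2.clm_apply (hasFDerivAt_const ((0 : E), q) (φ 1))
    rw [h3.fderiv]
    simp
  refine Eq.trans ?_ (congrArg₂ (fun a b : E => a - b) (hdW p q) (hdW q p))
  rw [GroupLieAlgebra.bracket_def, VectorField.mlieBracket,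
    VectorField.mlieBracketWithin_apply, mfderiv_extChartAt_self]
  simp only [modelWithCornersSelf_coe, Set.range_id, Set.preimage_univ, Set.univ_inter] at hW ⊢
  have hW1 : ∀ q : E, W q (φ 1) = q := fderiv_chartMul_one_inr
  have hlie : ∀ (V V' : E → E) (x : E), VectorField.lieBracketWithin ℝ V V' Set.univ x =
      VectorField.lieBracket ℝ V V' x := fun V V' x => by rw [VectorField.lieBracketWithin_univ]
  have h := (hW p).lieBracket_vectorField_eq (𝕜 := ℝ) (hW q)
  rw [VectorField.lieBracket_eq (V := W p)] at h
  refine Eq.trans ?_ ((hlie _ _ _).trans <| h.trans (congrArg₂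
    (fun a b : E => fderiv ℝ (W q) (φ 1) a - fderiv ℝ (W p) (φ 1) b) (hW1 p) (hW1 q)))
  exact congrArg (fun L : E →L[ℝ] E => L _) (ContinuousLinearMap.inverse_id (R := ℝ) (M := E))

variable (E G) in
/-- The differential of `Ad` at the identity, as a continuous bilinear map on the model space `E`.
By `adL_apply` it is the Lie bracket. -/
def adL : E →L[ℝ] E →L[ℝ] E := mfderiv 𝓘(ℝ, E) 𝓘(ℝ, E →L[ℝ] E) (Ad E : G → E →L[ℝ] E) 1

lemma hasMFDerivAt_Ad_one :
    HasMFDerivAt 𝓘(ℝ, E) 𝓘(ℝ, E →L[ℝ] E) (Ad E : G → E →L[ℝ] E) 1 (adL E G) :=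
  (contMDiff_Ad.mdifferentiable (by simp) 1).hasMFDerivAt

/-- Differentiating `eventually_fderiv_chartMul_inr_eq_inl` at the identity computes `ad`; the second
term is brought into the form of the bracket by the symmetry of the second derivative. -/
lemma adL_eq_fderiv_fderiv_chartMul (p q : E) :
    adL E G p q = fderiv ℝ (fderiv ℝ (chartMul (E := E) G))
        (extChartAt 𝓘(ℝ, E) (1 : G) 1, extChartAt 𝓘(ℝ, E) (1 : G) 1) (p, 0) (0, q) -
      fderiv ℝ (fderiv ℝ (chartMul (E := E) G))
        (extChartAt 𝓘(ℝ, E) (1 : G) 1, extChartAt 𝓘(ℝ, E) (1 : G) 1) (q, 0) (0, p) := by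
  set φ := extChartAt 𝓘(ℝ, E) (1 : G) with hφd
  have h1 : ContDiffAt ℝ 1 (fderiv ℝ (chartMul (E := E) G)) (φ 1, φ 1) :=
    (contDiffAt_chartMul (E := E) (G := G)).fderiv_right (m := 1) (n := ∞) (by norm_cast)
  have h1' := (h1.differentiableAt (by simp)).hasFDerivAt
  have hl : HasFDerivAt (fun z => fderiv ℝ (chartMul (E := E) G) (z, φ 1))
      ((fderiv ℝ (fderiv ℝ (chartMul (E := E) G)) (φ 1, φ 1)).comp
        (ContinuousLinearMap.inl ℝ E E)) (φ 1) :=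
    HasFDerivAt.comp (f := fun y : E => (y, φ 1)) (φ 1) h1' (hasFDerivAt_prodMk_left (φ 1) (φ 1))
  have hr : HasFDerivAt (fun z => fderiv ℝ (chartMul (E := E) G) (φ 1, z))
      ((fderiv ℝ (fderiv ℝ (chartMul (E := E) G)) (φ 1, φ 1)).comp
        (ContinuousLinearMap.inr ℝ E E)) (φ 1) :=
    HasFDerivAt.comp (f := fun y : E => (φ 1, y)) (φ 1) h1' (hasFDerivAt_prodMk_right (φ 1) (φ 1))
  have hA : HasFDerivAt (fun z => Ad E (φ.symm z)) (adL E G) (φ 1) := by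
    have h2 : HasMFDerivAt 𝓘(ℝ, E) 𝓘(ℝ, E →L[ℝ] E) (Ad E : G → E →L[ℝ] E) (φ.symm (φ 1))
        (adL E G) := by
      rw [hφd, chart_one_symm_apply]
      exact hasMFDerivAt_Ad_one
    exact (h2.comp (φ 1) hasMFDerivAt_chart_one_symm).hasFDerivAt
  have e1 := hl.clm_apply (hasFDerivAt_const ((0 : E), q) (φ 1))
  have e2 := hr.clm_apply
    ((hA.clm_apply (hasFDerivAt_const q (φ 1))).prodMk (hasFDerivAt_const (0 : E) (φ 1)))
  have e3 := e1.unique (e2.congr_of_eventuallyEq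
    ((eventually_fderiv_chartMul_inr_eq_inl (E := E) (G := G)).mono fun z hz => hz q))
  have e4 := congrArg (fun L : E →L[ℝ] E => L p) e3
  have hone : φ.symm (φ 1) = 1 := chart_one_symm_apply
  have hinl : ∀ v, fderiv ℝ (chartMul (E := E) G) (φ 1, φ 1) (v, 0) = v := fderiv_chartMul_one_inl
  have hsymm := ((contDiffAt_chartMul (E := E) (G := G)).of_le (m := 2)
    (by norm_cast)).isSymmSndFDerivAt (by simp) ((q : E), (0 : E)) ((0 : E), p)
  rw [hone] at e4
  simp [Ad_one_apply, hinl] at e4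
  rw [e4, hsymm]
  exact (add_sub_cancel_right _ _).symm

/-- The differential of the adjoint representation is the Lie bracket, which Mathlib defines by
left-invariant vector fields. -/
lemma adL_apply (p q : GroupLieAlgebra 𝓘(ℝ, E) G) :
    @Eq E (adL E G p q) (⁅p, q⁆ : GroupLieAlgebra 𝓘(ℝ, E) G) :=
  Eq.trans (α := E) (adL_eq_fderiv_fderiv_chartMul (E := E) (G := G) p q)
    (bracket_eq_fderiv_fderiv_chartMul p q).symm

lemma adL_self [FiniteDimensional ℝ E] (p : E) : adL E G p p = 0 := by
  have : LieGroup 𝓘(ℝ, E) (minSmoothness ℝ 3) G := by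
    rw [minSmoothness_of_isRCLikeNormedField]; infer_instance
  have : CompleteSpace E := FiniteDimensional.complete ℝ E
  exact Eq.trans (adL_apply (G := G) (E := E) p p)
    (lie_self (L := GroupLieAlgebra 𝓘(ℝ, E) G) p)

lemma adL_antisymm [FiniteDimensional ℝ E] (u v : E) : adL E G u v = -adL E G v u := by
  have h := adL_self (G := G) (u + v)
  simp only [map_add, add_apply, adL_self, zero_add, add_zero] at h
  exact eq_neg_of_add_eq_zero_right h

/-- The derivative of `Ad` along a curve `a` with `a' = a p` is `Ad_a ad_p`. -/
lemma HasLeftVelocity.hasDerivAt_Ad {a : ℝ → G} {p : E} {t : ℝ} (h : HasLeftVelocity a p t) :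
    HasDerivAt (fun s => Ad E (a s)) ((Ad E (a t)).comp (adL E G p)) t := by
  have h1 := h.mul_left (a t)⁻¹
  have h2 : HasMFDerivAt 𝓘(ℝ, E) 𝓘(ℝ, E →L[ℝ] E) (Ad E : G → E →L[ℝ] E) ((a t)⁻¹ * a t)
      (adL E G) := by
    rw [inv_mul_cancel]
    exact hasMFDerivAt_Ad_one
  have h3 : HasFDerivAt (fun s => Ad E ((a t)⁻¹ * a s))
      ((adL E G).comp ((1 : ℝ →L[ℝ] ℝ).smulRight (dL E ((a t)⁻¹ * a t) p))) t :=
    hasMFDerivAt_iff_hasFDerivAt.1 (HasMFDerivAt.comp (g := Ad E) t h2 h1)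
  have h4 : HasDerivAt (fun s => Ad E ((a t)⁻¹ * a s)) (adL E G p : E →L[ℝ] E) t := by
    refine h3.hasDerivAt.congr_deriv ?_
    change adL E G ((1 : ℝ) • dL E ((a t)⁻¹ * a t) p) = adL E G p
    rw [inv_mul_cancel, dL_one, one_smul]
    rfl
  have h5 := (hasDerivAt_const t (Ad E (a t))).clm_comp h4
  refine (h5.congr_deriv ?_).congr_of_eventuallyEq (Eventually.of_forall fun s => ?_)
  · simp
  · simp [← Ad_mul]

end Bracket

end LieGroup

/-! ### The exponential map of the Lie group -/

section LieGroup

variable {E : Type*} [NormedAddCommGroup E] [NormedSpace ℝ E]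
  {G : Type*} [TopologicalSpace G] [ChartedSpace E G] [Group G]

lemma lieExp_one_smul (v : E) : lieExp (G := G) ((1 : ℝ) • v : E) = lieExp (G := G) v :=
  congrArg lieExp (one_smul ℝ v)

variable [LieGroup 𝓘(ℝ, E) ∞ G]

section Exponential

variable [FiniteDimensional ℝ E] [T2Space G]

/-- Left-invariant vector fields are complete: an integral curve through `1` on `(-ε, ε)` is
carried to any other point by a left translation, so all integral curves live at least for the
time `ε`. -/
lemma exists_forall_hasLeftVelocity (v : E) :
    ∃ a : ℝ → G, (∀ t, HasLeftVelocity a v t) ∧ a 0 = 1 := by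
  have : LieGroup 𝓘(ℝ, E) (minSmoothness ℝ 3) G := by
    rw [minSmoothness_of_isRCLikeNormedField]; infer_instance
  have : CompleteSpace E := FiniteDimensional.complete ℝ E
  have hv := (contMDiff_mulInvariantVectorField (I := 𝓘(ℝ, E)) (G := G) v).of_le (m := 1)
    (by rw [minSmoothness_of_isRCLikeNormedField]; norm_num)
  obtain ⟨b, hb0, hb⟩ := exists_isMIntegralCurveAt_of_contMDiffAt_boundaryless (I := 𝓘(ℝ, E)) 0
    (hv.contMDiffAt (x := 1))
  obtain ⟨ε, hε, hb⟩ := isMIntegralCurveAt_iff'.1 hb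
  obtain ⟨a, ha0, ha⟩ := exists_isMIntegralCurve_of_isMIntegralCurveOn hv hε (fun x => by
    refine ⟨fun t => x * b t, by simp [hb0], fun t ht => ?_⟩
    have hball : Metric.ball (0 : ℝ) ε ∈ 𝓝 t := Metric.isOpen_ball.mem_nhds (by
      simpa [abs_lt] using ht)
    have h : HasLeftVelocity b v t := (hb t (mem_of_mem_nhds hball)).hasMFDerivAt hball
    exact HasMFDerivAt.hasMFDerivWithinAt (h.mul_left x)) 1
  exact ⟨a, ha, ha0⟩

lemma lieExp_smul_eq {v : E} {a : ℝ → G} (ha : ∀ t, HasLeftVelocity a v t) (h0 : a 0 = 1)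
    (t : ℝ) : lieExp (G := G) (t • v : E) = a t := by
  have hex : ∃ α : ℝ → G, IsMIntegralCurve (I := 𝓘(ℝ, E)) α
      (mulInvariantVectorField (t • v : E)) ∧ α 0 = 1 :=
    exists_forall_hasLeftVelocity (t • v)
  rw [show lieExp (G := G) (t • v : E) = hex.choose 1 from dif_pos hex]
  have h1 : ∀ s, HasLeftVelocity hex.choose (t • v) s := hex.choose_spec.1
  have h2 : ∀ s, HasLeftVelocity (fun s => a (t * s)) (t • v) s := fun s => by
    simpa using (ha (t * s)).comp ((hasDerivAt_id s).const_mul t)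
  have h3 := eq_of_hasLeftVelocity h1 h2 (by simp [hex.choose_spec.2, h0])
  rw [h3]
  exact congrArg a (mul_one t)

lemma hasLeftVelocity_lieExp (v : E) (t : ℝ) :
    HasLeftVelocity (fun s => lieExp (G := G) (s • v : E)) v t := by
  obtain ⟨a, ha, h0⟩ := exists_forall_hasLeftVelocity (G := G) v
  simpa only [lieExp_smul_eq ha h0] using ha t

lemma lieExp_zero_smul (v : E) : lieExp (G := G) ((0 : ℝ) • v : E) = 1 := by
  obtain ⟨a, ha, h0⟩ := exists_forall_hasLeftVelocity (G := G) v
  rw [lieExp_smul_eq ha h0, h0]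

/-- The Lie group exponential intertwines the adjoint action with conjugation. -/
lemma lieExp_Ad (x : G) (v : E) : lieExp (G := G) (Ad E x v) = x * lieExp (G := G) v * x⁻¹ := by
  rw [← lieExp_one_smul (G := G) v, ← lieExp_one_smul (G := G) (Ad E x v)]
  refine lieExp_smul_eq (a := fun t : ℝ => x * lieExp (G := G) (t • v : E) * x⁻¹) (fun t => ?_) ?_ 1
  · simpa using ((hasLeftVelocity_lieExp v t).mul_left x).mul_right x⁻¹
  · rw [lieExp_zero_smul]
    simp

/-- `Ad x` is an automorphism of the Lie algebra. -/
lemma Ad_adL (x : G) (p q : E) : Ad E x (adL E G p q) = adL E G (Ad E x p) (Ad E x q) := by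
  have hb := hasLeftVelocity_lieExp (G := G) p 0
  have h1 := (hasDerivAt_const (0 : ℝ) (Ad E x)).clm_comp hb.hasDerivAt_Ad
  have h2 := ((hb.mul_left x).mul_right x⁻¹).hasDerivAt_Ad.clm_comp
    (hasDerivAt_const (0 : ℝ) (Ad E x))
  have h3 := h1.unique (h2.congr_of_eventuallyEq (Eventually.of_forall fun s => by
    simp only [← Ad_mul]
    simp))
  have h4 := congrArg (fun L : E →L[ℝ] E => L q) h3
  simpa only [lieExp_zero_smul, Ad_one, ContinuousLinearMap.zero_comp, zero_add, inv_inv,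
    mul_one, mul_inv_cancel, ContinuousLinearMap.id_comp, ContinuousLinearMap.comp_zero, add_zero,
    ContinuousLinearMap.comp_apply] using h4

lemma hasDerivAt_Ad_lieExp (p q : E) (t : ℝ) :
    HasDerivAt (fun s => Ad E (lieExp (G := G) (s • p : E)) q)
      (Ad E (lieExp (G := G) (t • p : E)) (adL E G p q)) t := by
  have h := (hasLeftVelocity_lieExp (G := G) p t).hasDerivAt_Ad.clm_apply (hasDerivAt_const t q)
  simpa using h

lemma Ad_lieExp_self (p : E) (t : ℝ) : Ad E (lieExp (G := G) (t • p : E)) p = p := by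
  have h : ∀ s, HasDerivAt (fun s => Ad E (lieExp (G := G) (s • p : E)) p) 0 s := fun s => by
    simpa [adL_self] using hasDerivAt_Ad_lieExp (G := G) p p s
  have := is_const_of_deriv_eq_zero (fun s => (h s).differentiableAt) (fun s => (h s).deriv) t 0
  simpa only [lieExp_zero_smul, Ad_one_apply] using this

/-- `t ↦ Ad (exp (t p)) q` solves the linear equation `u' = [p, u]`. -/
lemma hasDerivAt_Ad_lieExp' (p q : E) (t : ℝ) :
    HasDerivAt (fun s => Ad E (lieExp (G := G) (s • p : E)) q)
      (adL E G p (Ad E (lieExp (G := G) (t • p : E)) q)) t := by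
  have h := hasDerivAt_Ad_lieExp (G := G) p q t
  rwa [Ad_adL, Ad_lieExp_self] at h

end Exponential

section Smooth

/-- A curve with `γ' = γ u`, read in the chart at the identity. -/
lemma HasLeftVelocity.hasDerivAt_chart {γ : ℝ → G} {u : E} {t : ℝ} (h : HasLeftVelocity γ u t)
    (hs : γ t ∈ (extChartAt 𝓘(ℝ, E) (1 : G)).source)
    (hd : DifferentiableAt ℝ (chartMul (E := E) G)
      (extChartAt 𝓘(ℝ, E) (1 : G) (γ t), extChartAt 𝓘(ℝ, E) (1 : G) 1)) :
    HasDerivAt (fun s => extChartAt 𝓘(ℝ, E) (1 : G) (γ s))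
      (fderiv ℝ (chartMul (E := E) G)
        (extChartAt 𝓘(ℝ, E) (1 : G) (γ t), extChartAt 𝓘(ℝ, E) (1 : G) 1) (0, u)) t := by
  set φ := extChartAt 𝓘(ℝ, E) (1 : G) with hφd
  obtain ⟨L, hL⟩ : ∃ L : E →L[ℝ] E, HasMFDerivAt 𝓘(ℝ, E) 𝓘(ℝ, E) φ (γ t) L := by
    rw [hφd, extChartAt_source] at hs
    exact ⟨_, (mdifferentiableAt_extChartAt hs).hasMFDerivAt⟩
  have hL' : HasMFDerivAt 𝓘(ℝ, E) 𝓘(ℝ, E) φ (φ.symm (φ (γ t))) L := by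
    rwa [φ.left_inv hs]
  have h3 := fderiv_chartMul_inr (G := G) hL' hd u
  rw [← hφd, φ.left_inv hs] at h3
  have h4 : HasFDerivAt (fun s => φ (γ s))
      (L.comp ((1 : ℝ →L[ℝ] ℝ).smulRight (dL E (γ t) u))) t :=
    hasMFDerivAt_iff_hasFDerivAt.1 (HasMFDerivAt.comp (g := φ) t hL h)
  refine h4.hasDerivAt.congr_deriv (Eq.trans ?_ h3.symm)
  simp

/-- A solution of an autonomous differential equation with smooth right-hand side is smooth. -/
lemma contDiffAt_of_eventually_hasDerivAt {X : E → E} {z : ℝ → E} {t : ℝ}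
    (hX : ContDiffAt ℝ ∞ X (z t)) (hz : ∀ᶠ s in 𝓝 t, HasDerivAt z (X (z s)) s) :
    ContDiffAt ℝ ∞ z t := by
  rw [contDiffAt_infty]
  intro n
  induction n with
  | zero =>
    rw [Nat.cast_zero, contDiffAt_zero]
    exact ⟨_, hz, fun s hs => (HasDerivAt.continuousAt hs).continuousWithinAt⟩
  | succ n ih =>
    rw [Nat.cast_add, Nat.cast_one, contDiffAt_succ_iff_hasFDerivAt]
    refine ⟨fun s => (1 : ℝ →L[ℝ] ℝ).smulRight (X (z s)), ⟨_, hz, fun s hs => ?_⟩, ?_⟩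
    · exact HasDerivAt.hasFDerivAt hs
    · exact contDiffAt_const.smulRight ((hX.of_le (by exact_mod_cast le_top)).comp t ih)

variable [FiniteDimensional ℝ E] [T2Space G]

/-- Near `0` the one-parameter group solves a smooth differential equation in the chart; elsewhere it
is a translate of its germ at `0`. -/
lemma contMDiff_lieExp_smul (v : E) :
    ContMDiff 𝓘(ℝ, ℝ) 𝓘(ℝ, E) ∞ (fun s : ℝ => lieExp (G := G) (s • v : E)) := by
  set φ := extChartAt 𝓘(ℝ, E) (1 : G) with hφd
  set a : ℝ → G := fun s : ℝ => lieExp (G := G) (s • v : E) with had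
  have ha : ∀ t, HasLeftVelocity a v t := hasLeftVelocity_lieExp v
  have ha0 : a 0 = 1 := lieExp_zero_smul v
  have hev := eventually_differentiableAt_chartMul (E := E) (G := G)
  have hz0 : φ (a 0) = φ 1 := by rw [ha0]
  have c1 : Tendsto (fun s : ℝ => (φ (a s), φ 1)) (𝓝 0) (𝓝 (φ 1, φ 1)) := by
    rw [nhds_prod_eq]
    refine Tendsto.prodMk ?_ tendsto_const_nhds
    rw [← hz0]
    refine ContinuousAt.comp (g := φ) ?_ (ha 0).continuousAt
    rw [ha0]
    exact continuousAt_extChartAt _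
  have hs : ∀ᶠ s in 𝓝 (0 : ℝ), a s ∈ φ.source := (ha 0).continuousAt (by
    rw [ha0]; exact extChartAt_source_mem_nhds _)
  have hX : ContDiffAt ℝ ∞ (fun z => fderiv ℝ (chartMul (E := E) G) (z, φ 1) (0, v)) (φ (a 0)) := by
    rw [hz0]
    have h1 : ContDiffAt ℝ ∞ (fderiv ℝ (chartMul (E := E) G)) (φ 1, φ 1) :=
      (contDiffAt_chartMul (E := E) (G := G)).fderiv_right (m := ∞) (n := ∞) le_rfl
    have h2 : ContDiffAt ℝ ∞ (fun z : E => (z, φ 1)) (φ 1) := by fun_prop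
    exact (ContDiffAt.comp (f := fun z : E => (z, φ 1)) (φ 1) h1 h2).clm_apply contDiffAt_const
  have hz : ∀ᶠ s in 𝓝 (0 : ℝ), HasDerivAt (fun s => φ (a s))
      (fderiv ℝ (chartMul (E := E) G) (φ (a s), φ 1) (0, v)) s := by
    filter_upwards [hs, c1.eventually hev] with s hs hd
    exact (ha s).hasDerivAt_chart hs hd
  have hsm0 : ContMDiffAt 𝓘(ℝ, ℝ) 𝓘(ℝ, E) ∞ a 0 := by
    have h1 := (contDiffAt_of_eventually_hasDerivAt (z := fun s => φ (a s)) hX hz).contMDiffAt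
    have h2 : ContMDiffAt 𝓘(ℝ, E) 𝓘(ℝ, E) ∞ φ.symm (φ (a 0)) := by
      rw [hz0]; exact contMDiffAt_chart_one_symm
    refine (ContMDiffAt.comp (0 : ℝ) h2 h1).congr_of_eventuallyEq ?_
    filter_upwards [hs] with s hs
    exact (φ.left_inv hs).symm
  intro t
  have h1 : (fun s => a (s + t)) = fun s => a t * a s := by
    refine eq_of_hasLeftVelocity (u := fun _ => v) (fun s => ?_) (fun s => (ha s).mul_left (a t)) ?_
    · simpa using HasLeftVelocity.comp (f := fun s => s + t) (ha (s + t))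
        ((hasDerivAt_id s).add_const t)
    · simp [ha0]
  have h1' : a = fun s => a t * a (s - t) := by
    ext s
    simpa using congrFun h1 (s - t)
  rw [h1']
  have h2 : ContMDiffAt 𝓘(ℝ, ℝ) 𝓘(ℝ, ℝ) ∞ (fun s : ℝ => s - t) t :=
    ContDiffAt.contMDiffAt (by fun_prop)
  have h3 : ContMDiffAt 𝓘(ℝ, ℝ) 𝓘(ℝ, E) ∞ a (t - t) := by rwa [sub_self]
  exact contMDiffAt_const.mul (ContMDiffAt.comp (f := fun s : ℝ => s - t) t h3 h2)

end Smooth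

/-! ### Differentiability of the exponential map of the Lie group -/

section Differentiability

/-- In the chart at the identity the left-invariant fields are nearly constant near `1`. -/
lemma exists_closedBall_chartMul {ε : ℝ} (hε : 0 < ε) :
    ∃ r > 0, ∀ z ∈ Metric.closedBall (extChartAt 𝓘(ℝ, E) (1 : G) 1) r,
      z ∈ (extChartAt 𝓘(ℝ, E) (1 : G)).target ∧
      DifferentiableAt ℝ (chartMul (E := E) G) (z, extChartAt 𝓘(ℝ, E) (1 : G) 1) ∧
      ∀ v : E, ‖fderiv ℝ (chartMul (E := E) G) (z, extChartAt 𝓘(ℝ, E) (1 : G) 1) (0, v) - v‖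
        ≤ ε * ‖v‖ := by
  set φ := extChartAt 𝓘(ℝ, E) (1 : G) with hφd
  have c1 : Tendsto (fun z : E => (z, φ 1)) (𝓝 (φ 1)) (𝓝 (φ 1, φ 1)) :=
    (by fun_prop : Continuous fun z : E => (z, φ 1)).continuousAt
  have hev := c1.eventually (eventually_differentiableAt_chartMul (E := E) (G := G))
  have h1 : ContDiffAt ℝ 1 (fderiv ℝ (chartMul (E := E) G)) (φ 1, φ 1) :=
    (contDiffAt_chartMul (E := E) (G := G)).fderiv_right (m := 1) (n := ∞) (by norm_cast)
  have h2 := (h1.continuousAt.tendsto.comp c1)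
  have h3 : ∀ᶠ z in 𝓝 (φ 1), ‖fderiv ℝ (chartMul (E := E) G) (z, φ 1) -
      fderiv ℝ (chartMul (E := E) G) (φ 1, φ 1)‖ < ε := by
    have := (Metric.tendsto_nhds.1 h2) ε hε
    simpa [dist_eq_norm] using this
  have h0 : ∀ᶠ z in 𝓝 (φ 1), z ∈ φ.target := extChartAt_target_mem_nhds (1 : G)
  obtain ⟨r, hr, hball⟩ := Metric.nhds_basis_closedBall.eventually_iff.1 (h0.and (hev.and h3))
  refine ⟨r, hr, fun z hz => ⟨(hball hz).1, (hball hz).2.1, fun v => ?_⟩⟩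
  have h4 := (fderiv ℝ (chartMul (E := E) G) (z, φ 1) -
      fderiv ℝ (chartMul (E := E) G) (φ 1, φ 1)).le_opNorm (0, v)
  rw [sub_apply, fderiv_chartMul_one_inr] at h4
  refine h4.trans ?_
  have h5 : ‖((0 : E), v)‖ = ‖v‖ := by simp [Prod.norm_def]
  rw [h5]
  exact mul_le_mul_of_nonneg_right (hball hz).2.2.le (norm_nonneg _)

variable [FiniteDimensional ℝ E] [T2Space G]

/-- A curve through the identity with small left velocity stays, for unit time, in a small ball of
the chart at the identity. -/
lemma mem_of_norm_leftVelocity_le {r κ : ℝ} (hr : 0 < r) (hκ : 4 * κ ≤ r)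
    (hball : ∀ z ∈ Metric.closedBall (extChartAt 𝓘(ℝ, E) (1 : G) 1) r,
      z ∈ (extChartAt 𝓘(ℝ, E) (1 : G)).target ∧
      DifferentiableAt ℝ (chartMul (E := E) G) (z, extChartAt 𝓘(ℝ, E) (1 : G) 1) ∧
      ∀ v : E, ‖fderiv ℝ (chartMul (E := E) G) (z, extChartAt 𝓘(ℝ, E) (1 : G) 1) (0, v) - v‖
        ≤ 1 * ‖v‖)
    {y : ℝ → G} {c : ℝ → E} (hy0 : y 0 = 1) (hy : ∀ t, HasLeftVelocity y (c t) t)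
    (hc : ∀ t ∈ Set.Icc (0 : ℝ) 1, ‖c t‖ ≤ κ) :
    ∀ t ∈ Set.Icc (0 : ℝ) 1, y t ∈ (extChartAt 𝓘(ℝ, E) (1 : G)).source ∧
      extChartAt 𝓘(ℝ, E) (1 : G) (y t) ∈
        Metric.closedBall (extChartAt 𝓘(ℝ, E) (1 : G) 1) r := by
  set φ := extChartAt 𝓘(ℝ, E) (1 : G) with hφd
  have hκ0 : 0 ≤ κ := (norm_nonneg _).trans (hc 0 (by simp))
  have hproper : ProperSpace E := FiniteDimensional.proper ℝ E
  have hyc : Continuous y := continuous_iff_continuousAt.2 fun t => (hy t).continuousAt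
  let K : Set G := φ.symm '' Metric.closedBall (φ 1) (r / 2)
  have hsub : Metric.closedBall (φ 1) (r / 2) ⊆ Metric.closedBall (φ 1) r :=
    Metric.closedBall_subset_closedBall (by linarith)
  have hKc : IsClosed K := by
    refine IsCompact.isClosed ((isCompact_closedBall _ _).image_of_continuousOn ?_)
    exact (continuousOn_extChartAt_symm (1 : G)).mono fun z hz => (hball z (hsub hz)).1
  have hKs : ∀ x ∈ K, x ∈ φ.source ∧ φ x ∈ Metric.closedBall (φ 1) (r / 2) := by
    rintro _ ⟨z, hz, rfl⟩
    have hzt := (hball z (hsub hz)).1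
    exact ⟨φ.map_target hzt, by rwa [φ.right_inv hzt]⟩
  -- The second condition bounds the distance travelled, so that the set is open to the right.
  let S : Set ℝ := {t | y t ∈ K ∧ ‖φ (y t) - φ 1‖ ≤ 2 * κ * t}
  suffices h : Set.Icc (0 : ℝ) 1 ⊆ S from fun t ht =>
    ⟨(hKs _ (h ht).1).1, hsub (hKs _ (h ht).1).2⟩
  have hφc : ContinuousOn (fun t => φ (y t)) (y ⁻¹' K) := fun t ht =>
    (ContinuousAt.comp (g := φ) (continuousAt_extChartAt' (hKs _ ht).1)
      hyc.continuousAt).continuousWithinAt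
  refine IsClosed.Icc_subset_of_forall_exists_gt ?_ ?_ ?_
  · have h1 : ContinuousOn (fun t => ‖φ (y t) - φ 1‖ - 2 * κ * t) (y ⁻¹' K) :=
      (hφc.sub continuousOn_const).norm.sub (by fun_prop)
    have h2 := h1.preimage_isClosed_of_isClosed (hKc.preimage hyc) (isClosed_Iic (a := (0 : ℝ)))
    have h3 : S = y ⁻¹' K ∩ (fun t => ‖φ (y t) - φ 1‖ - 2 * κ * t) ⁻¹' Set.Iic 0 := by
      ext t; simp [S]
    rw [h3]
    exact h2.inter isClosed_Icc
  · exact ⟨⟨φ 1, Metric.mem_closedBall_self (by positivity), by rw [hy0]; simp [φ]⟩, by simp [hy0]⟩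
  · rintro t ⟨⟨htK, htn⟩, ht0, ht1⟩ b hb
    have hts := (hKs _ htK).1
    have hev : ∀ᶠ s in 𝓝 t, y s ∈ φ.source ∧ φ (y s) ∈ Metric.ball (φ 1) r := by
      have hcont : ContinuousAt (fun s => φ (y s)) t :=
        ContinuousAt.comp (g := φ) (continuousAt_extChartAt' hts) hyc.continuousAt
      have hsrc : ∀ᶠ s in 𝓝 t, y s ∈ φ.source :=
        hyc.continuousAt ((isOpen_extChartAt_source (1 : G)).mem_nhds hts)
      refine hsrc.and (hcont (Metric.isOpen_ball.mem_nhds ?_))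
      exact Metric.closedBall_subset_ball (by linarith) (hKs _ htK).2
    obtain ⟨e, he, hball'⟩ := Metric.eventually_nhds_iff_ball.1 hev
    let s := min (min b 1) (t + e / 2)
    have hts' : t < s := by simp only [s, lt_min_iff]; exact ⟨⟨hb, ht1⟩, by linarith⟩
    have hs1 : s ≤ 1 := (min_le_left _ _).trans (min_le_right _ _)
    have hin : ∀ x ∈ Set.Icc t s, y x ∈ φ.source ∧ φ (y x) ∈ Metric.ball (φ 1) r := fun x hx => by
      refine hball' x ?_
      have : s ≤ t + e / 2 := min_le_right _ _
      rw [Metric.mem_ball, Real.dist_eq, abs_lt]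
      constructor <;> linarith [hx.1, hx.2]
    have hmv : ‖φ (y s) - φ (y t)‖ ≤ 2 * κ * (s - t) := by
      refine norm_image_sub_le_of_norm_deriv_le_segment' (f := fun x => φ (y x))
        (f' := fun x => fderiv ℝ (chartMul (E := E) G) (φ (y x), φ 1) (0, c x))
        (fun x hx => ?_) (fun x hx => ?_) s (Set.right_mem_Icc.2 hts'.le)
      · have hb := hball _ (Metric.ball_subset_closedBall (hin x hx).2)
        exact ((hy x).hasDerivAt_chart (hin x hx).1 hb.2.1).hasDerivWithinAt
      · have hx' := Set.Ico_subset_Icc_self hx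
        have hb := (hball _ (Metric.ball_subset_closedBall (hin x hx').2)).2.2 (c x)
        have hcx := hc x ⟨ht0.trans hx.1, hx.2.le.trans hs1⟩
        have := norm_le_norm_add_norm_sub' (fderiv ℝ (chartMul (E := E) G) (φ (y x), φ 1) (0, c x))
          (c x)
        linarith
    have hns : ‖φ (y s) - φ 1‖ ≤ 2 * κ * s := by
      have := norm_sub_le_norm_sub_add_norm_sub (φ (y s)) (φ (y t)) (φ 1)
      linarith
    refine ⟨s, ⟨⟨φ (y s), ?_, φ.left_inv (hin s (Set.right_mem_Icc.2 hts'.le)).1⟩, hns⟩, hts',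
      (min_le_left _ _).trans (min_le_left _ _)⟩
    rw [Metric.mem_closedBall, dist_eq_norm]
    nlinarith

/-- The endpoint of a curve through the identity with small left velocity `c` is, in the chart,
the integral of `c` up to an error of higher order. -/
lemma exists_norm_chart_sub_le {ε : ℝ} (hε : 0 < ε) :
    ∃ η > 0, ∀ (y : ℝ → G) (c Z : ℝ → E) (κ : ℝ), κ ≤ η → y 0 = 1 →
      (∀ t, HasLeftVelocity y (c t) t) → (∀ t ∈ Set.Icc (0 : ℝ) 1, ‖c t‖ ≤ κ) →
      Z 0 = 0 → (∀ t, HasDerivAt Z (c t) t) →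
      y 1 ∈ (extChartAt 𝓘(ℝ, E) (1 : G)).source ∧
      ‖extChartAt 𝓘(ℝ, E) (1 : G) (y 1) - extChartAt 𝓘(ℝ, E) (1 : G) 1 - Z 1‖ ≤ ε * κ := by
  obtain ⟨r, hr, hball⟩ := exists_closedBall_chartMul (E := E) (G := G)
    (ε := min ε 1) (by positivity)
  set φ := extChartAt 𝓘(ℝ, E) (1 : G) with hφd
  -- The factor `4` leaves room for the speed bound `2 κ` and the ball of radius `r / 2` in
  -- `mem_of_norm_leftVelocity_le`.
  refine ⟨r / 4, by positivity, fun y c Z κ hκ hy0 hy hc hZ0 hZ => ?_⟩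
  have hmem := mem_of_norm_leftVelocity_le hr (κ := κ) (by linarith) (fun z hz => by
    refine ⟨(hball z hz).1, (hball z hz).2.1, fun v => ((hball z hz).2.2 v).trans ?_⟩
    exact mul_le_mul_of_nonneg_right (min_le_right _ _) (norm_nonneg _)) hy0 hy hc
  refine ⟨(hmem 1 (by simp)).1, ?_⟩
  have hmv := norm_image_sub_le_of_norm_deriv_le_segment_01' (f := fun x => φ (y x) - Z x)
    (f' := fun x => fderiv ℝ (chartMul (E := E) G) (φ (y x), φ 1) (0, c x) - c x)
    (C := ε * κ) (fun x hx => ?_) (fun x hx => ?_)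
  · rw [hy0, hZ0] at hmv
    rwa [show φ (y 1) - φ 1 - Z 1 = φ (y 1) - Z 1 - (φ 1 - 0) by abel]
  · exact (((hy x).hasDerivAt_chart (hmem x hx).1
      (hball _ (hmem x hx).2).2.1).sub (hZ x)).hasDerivWithinAt
  · have hx' := Set.Ico_subset_Icc_self hx
    refine ((hball _ (hmem x hx').2).2.2 (c x)).trans ?_
    exact mul_le_mul (min_le_left _ _) (hc x hx') (norm_nonneg _) hε.le

/-- The Lie group exponential is differentiable: the curve
`t ↦ exp (t (w + h)) exp (t w)⁻¹` has left velocity `Ad (exp (t w)) h`, which is linear in `h`. -/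
lemma mdifferentiableAt_lieExp (w : E) :
    MDifferentiableAt 𝓘(ℝ, E) 𝓘(ℝ, E) (fun v : E => lieExp (G := G) v) w := by
  set φ := extChartAt 𝓘(ℝ, E) (1 : G) with hφd
  let C : ℝ → E →L[ℝ] E := fun t => Ad E (lieExp (G := G) (t • w : E))
  have hC : Continuous C := continuous_iff_continuousAt.2 fun t =>
    (hasLeftVelocity_lieExp (G := G) w t).hasDerivAt_Ad.continuousAt
  have : CompleteSpace E := FiniteDimensional.complete ℝ E
  let J : ℝ → E →L[ℝ] E := fun t => ∫ s in (0 : ℝ)..t, C s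
  have hJ : ∀ t, HasDerivAt J (C t) t := fun t => (hC.integral_hasStrictDerivAt 0 t).hasDerivAt
  obtain ⟨M, hM⟩ := (isCompact_Icc (a := (0 : ℝ)) (b := 1)).exists_bound_of_continuousOn
    hC.continuousOn
  let y : E → ℝ → G := fun h t =>
    lieExp (G := G) (t • (w + h) : E) * (lieExp (G := G) (t • w : E))⁻¹
  have hy : ∀ h t, HasLeftVelocity (y h) (C t h) t := fun h t => by
    have h1 := (hasLeftVelocity_lieExp (G := G) (w + h) t).mul (hasLeftVelocity_lieExp w t).inv
    rwa [inv_inv, map_add, Ad_lieExp_self, add_neg_cancel_comm] at h1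
  have hy0 : ∀ h, y h 0 = 1 := fun h => by
    simp only [y]
    rw [lieExp_zero_smul, lieExp_zero_smul, inv_one, mul_one]
  have hkey : ∀ ε > 0, ∀ᶠ h in 𝓝 (0 : E), y h 1 ∈ φ.source ∧
      ‖φ (y h 1) - φ 1 - J 1 h‖ ≤ ε * ((|M| + 1) * ‖h‖) := by
    intro ε hε
    obtain ⟨η, hη, H⟩ := exists_norm_chart_sub_le (E := E) (G := G) hε
    have hsmall : ∀ᶠ h in 𝓝 (0 : E), (|M| + 1) * ‖h‖ < η :=
      ((by fun_prop : Continuous fun h : E => (|M| + 1) * ‖h‖).tendsto' 0 0 (by simp)).eventually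
        (gt_mem_nhds hη)
    filter_upwards [hsmall] with h hh
    refine H (y h) (fun t => C t h) (fun t => J t h) _ hh.le (hy0 h) (hy h) (fun t ht => ?_) ?_
      (fun t => ?_)
    · refine ((C t).le_opNorm h).trans (mul_le_mul_of_nonneg_right ?_ (norm_nonneg _))
      exact (hM t ht).trans ((le_abs_self M).trans (by linarith))
    · simp [J]
    · simpa using (hJ t).clm_apply (hasDerivAt_const t h)
  have hyz : y 0 1 = 1 := by simp [y]
  have hF : HasFDerivAt (fun h => φ (y h 1)) (J 1) 0 := by
    rw [hasFDerivAt_iff_isLittleO_nhds_zero, Asymptotics.isLittleO_iff]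
    intro ε hε
    filter_upwards [hkey (ε / (|M| + 1)) (by positivity)] with h hh
    rw [zero_add, hyz]
    refine hh.2.trans (le_of_eq ?_)
    field_simp
  have hF' : MDifferentiableAt 𝓘(ℝ, E) 𝓘(ℝ, E) (fun h => y h 1) 0 := by
    have h1 : MDifferentiableAt 𝓘(ℝ, E) 𝓘(ℝ, E) φ.symm (φ (y 0 1)) := by
      rw [hyz]
      exact contMDiffAt_chart_one_symm.mdifferentiableAt (by simp)
    refine (MDifferentiableAt.comp (0 : E) h1
      hF.differentiableAt.mdifferentiableAt).congr_of_eventuallyEq ?_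
    filter_upwards [hkey 1 one_pos] with h hh
    exact (φ.left_inv hh.1).symm
  have h2 : MDifferentiableAt 𝓘(ℝ, E) 𝓘(ℝ, E) (fun v => y (v - w) 1) w := by
    have h3 : MDifferentiableAt 𝓘(ℝ, E) 𝓘(ℝ, E) (fun h => y h 1) (w - w) := by rwa [sub_self]
    exact MDifferentiableAt.comp (f := fun v : E => v - w) w h3
      (DifferentiableAt.mdifferentiableAt (by fun_prop))
  have h4 := MDifferentiableAt.comp w
    ((contMDiff_mul_right (I := 𝓘(ℝ, E)) (n := ∞) (a := lieExp (G := G) w)).mdifferentiableAt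
      (by simp)) h2
  refine h4.congr_of_eventuallyEq (Eventually.of_forall fun v => ?_)
  simp [y]

end Differentiability

end LieGroup

/-! ### The Euler-Arnold equation of the deformed metric -/

section CheegerAlgebra

variable {V : Type*} [AddCommGroup V] [Module ℝ V]

lemma InnerProd.ext_left (g : InnerProd V) {x y : V} (h : ∀ w, g.form x w = g.form y w) :
    x = y := by
  have h1 := h (x - y)
  rw [← sub_eq_zero, ← LinearMap.sub_apply, ← map_sub] at h1
  by_contra hne
  exact (g.pos _ (sub_ne_zero.2 hne)).ne' h1

variable [FiniteDimensional ℝ V]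

lemma InnerProd.proj_of_mem (B : InnerProd V) {W : Submodule ℝ V} {w : V} (hw : w ∈ W) :
    B.proj W w = w := by
  have h := B.form_sub_proj W w (w - B.proj W w) (W.sub_mem hw (B.proj_mem W w))
  by_contra hne
  exact (B.pos _ (sub_ne_zero.2 (Ne.symm hne))).ne' h

lemma InnerProd.proj_of_orthogonal (B : InnerProd V) {W : Submodule ℝ V} {y : V}
    (hy : ∀ w ∈ W, B.form w y = 0) : B.proj W y = 0 := by
  have h := B.form_sub_proj W y _ (B.proj_mem W y)
  rw [map_sub, hy _ (B.proj_mem W y), zero_sub, neg_eq_zero] at h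
  by_contra hne
  exact (B.pos _ hne).ne' h

lemma InnerProd.form_proj_left (B : InnerProd V) (W : Submodule ℝ V) (u v : V) :
    B.form (B.proj W u) v = B.form (B.proj W u) (B.proj W v) := by
  have h := B.form_sub_proj W v _ (B.proj_mem W u)
  rwa [map_sub, sub_eq_zero] at h

lemma InnerProd.lam_apply (B : InnerProd V) (W : Submodule ℝ V) (δ : ℝ) (u : V) :
    B.lam W δ u = u + δ • B.proj W u := by
  simp [InnerProd.lam]

lemma InnerProd.cheeger_form (B : InnerProd V) (W : Submodule ℝ V) (δ : ℝ) (hδ : -1 < δ)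
    (u v : V) : (B.cheeger W δ hδ).form u v = B.form (B.lam W δ u) v := by
  rw [B.lam_apply, map_add, LinearMap.add_apply, map_smul, LinearMap.smul_apply,
    B.form_proj_left]
  rfl

variable {br : V → V →ₗ[ℝ] V} {B : InnerProd V} {W : Submodule ℝ V}

/-- For `p` in the subalgebra `W`, the skew map `ad_p` preserves `W` and its orthogonal
complement, so it commutes with the orthogonal projection. -/
lemma InnerProd.proj_bracket (hskew : ∀ u v w, B.form (br u v) w + B.form v (br u w) = 0)
    (hW : ∀ u ∈ W, ∀ v ∈ W, br u v ∈ W) {p : V} (hp : p ∈ W) (x : V) :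
    B.proj W (br p x) = br p (B.proj W x) := by
  have h1 : br p x = br p (B.proj W x) + br p (x - B.proj W x) := by
    rw [← map_add, add_sub_cancel]
  have h2 : B.proj W (br p (x - B.proj W x)) = 0 := B.proj_of_orthogonal fun w hw => by
    have h := hskew p w (x - B.proj W x)
    rwa [B.form_sub_proj W x _ (hW p hp w hw), zero_add] at h
  rw [h1, map_add, h2, add_zero, B.proj_of_mem (hW p hp _ (B.proj_mem W x))]

/-- The vector `δ [P u, u]` has the property that defines `ad*_u u` for the deformed metric. -/
lemma InnerProd.cheeger_form_bracket
    (hskew : ∀ u v w, B.form (br u v) w + B.form v (br u w) = 0)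
    (hanti : ∀ u v, br u v = -br v u) (hself : ∀ u, br u u = 0)
    (hW : ∀ u ∈ W, ∀ v ∈ W, br u v ∈ W) {δ : ℝ} (hδ : -1 < δ) (u w : V) :
    (B.cheeger W δ hδ).form (δ • br (B.proj W u) u) w =
      (B.cheeger W δ hδ).form u (br u w) := by
  have h1 : B.proj W (br (B.proj W u) u) = 0 := by
    rw [B.proj_bracket hskew hW (B.proj_mem W u), hself]
  have h2 : br u (B.lam W δ u) = -(δ • br (B.proj W u) u) := by
    rw [B.lam_apply, map_add, hself, zero_add, map_smul, hanti u, smul_neg]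
  have h3 := hskew u (B.lam W δ u) w
  rw [h2, map_neg, LinearMap.neg_apply, neg_add_eq_zero] at h3
  rw [B.cheeger_form, B.cheeger_form, ← h3, B.lam_apply, map_smul, h1, smul_zero, smul_zero,
    add_zero]

end CheegerAlgebra

section Subgroup

variable {E : Type*} [NormedAddCommGroup E] [NormedSpace ℝ E]
  {G : Type*} [TopologicalSpace G] [ChartedSpace E G] [Group G]
  [LieGroup 𝓘(ℝ, E) ∞ G]
  {F : Type*} [NormedAddCommGroup F] [NormedSpace ℝ F]
  {K : Type*} [TopologicalSpace K] [ChartedSpace F K] [Group K] [LieGroup 𝓘(ℝ, F) ∞ K]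

/-- The differential of a smooth homomorphism is a homomorphism of Lie algebras: differentiate
`Ad (ι k) (L b) = L (Ad k b)` at `k = 1`. -/
lemma adL_map {ι : K →* G} {L : F →L[ℝ] E} (hL : HasMFDerivAt 𝓘(ℝ, F) 𝓘(ℝ, E) ι 1 L)
    (a b : F) :
    adL E G (L a) (L b) = L (adL F K a b) := by
  -- Differentiate `ι (k y k⁻¹) = ι k * ι y * (ι k)⁻¹` in `y` at the identity.
  have hAd : ∀ k : K, Ad E (ι k) (L b) = L (Ad F k b) := fun k => by
    have h1 : HasMFDerivAt 𝓘(ℝ, F) 𝓘(ℝ, E) ι (k * 1 * k⁻¹) L := by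
      rw [mul_one, mul_inv_cancel]; exact hL
    have h2 : HasMFDerivAt 𝓘(ℝ, E) 𝓘(ℝ, E) (fun y : G => ι k * y * (ι k)⁻¹) (ι 1) (Ad E (ι k)) := by
      rw [map_one]; exact hasMFDerivAt_Ad _
    have h3 := h1.comp 1 (hasMFDerivAt_Ad (E := F) k)
    have h4 := h2.comp 1 hL
    have h5 : ι ∘ (fun y : K => k * y * k⁻¹) = (fun y : G => ι k * y * (ι k)⁻¹) ∘ ι := by
      ext; simp
    rw [h5] at h3
    exact congrArg (fun M : F →L[ℝ] E => M b) (hasMFDerivAt_unique h4 h3)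
  have h1 : HasMFDerivAt 𝓘(ℝ, E) 𝓘(ℝ, E →L[ℝ] E) (Ad E : G → E →L[ℝ] E) (ι 1) (adL E G) := by
    rw [map_one]; exact hasMFDerivAt_Ad_one
  have h2 := h1.comp 1 hL
  let ev : (E →L[ℝ] E) →L[ℝ] E := ContinuousLinearMap.apply ℝ E (L b)
  let ev' : (F →L[ℝ] F) →L[ℝ] E := L.comp (ContinuousLinearMap.apply ℝ F b)
  have h3 := HasMFDerivAt.comp (g := ev) 1 ev.hasFDerivAt.hasMFDerivAt h2
  have h4 : HasMFDerivAt 𝓘(ℝ, F) 𝓘(ℝ, F →L[ℝ] F) (Ad F : K → F →L[ℝ] F) 1 (adL F K) :=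
    hasMFDerivAt_Ad_one
  have h5 := HasMFDerivAt.comp (g := ev') 1 ev'.hasFDerivAt.hasMFDerivAt h4
  have h6 : ev' ∘ (Ad F : K → F →L[ℝ] F) = ev ∘ (Ad E ∘ ι) := by
    ext k; exact (hAd k).symm
  rw [h6] at h5
  exact congrArg (fun M : F →L[ℝ] E => M a) (hasMFDerivAt_unique h3 h5)

/-- The Lie algebra of a Lie subgroup is a subalgebra. -/
lemma adL_mem_subgroupLieAlgebra {ι : K →* G} (hι : IsLieSubgroup E F ι)
    (p q : E) (hp : p ∈ subgroupLieAlgebra E F ι) (hq : q ∈ subgroupLieAlgebra E F ι) :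
    adL E G p q ∈ subgroupLieAlgebra E F ι := by
  have hL := (hι.smooth.mdifferentiable (by simp) 1).hasMFDerivAt
  obtain ⟨a, rfl⟩ := hp
  obtain ⟨b, rfl⟩ := hq
  exact ⟨adL F K a b, (adL_map hL a b).symm⟩

end Subgroup

section EulerArnold

variable {E : Type*} [NormedAddCommGroup E] [NormedSpace ℝ E]
  {G : Type*} [TopologicalSpace G] [ChartedSpace E G] [Group G]
  [LieGroup 𝓘(ℝ, E) ∞ G]

/-- The inner products and Lie algebra elements of the following lemmas live on the model space `E`,
which carries the norm; this is `IsBiInvariant` read there. -/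
lemma isBiInvariant_iff_adL {B : InnerProd E} :
    IsBiInvariant (E := E) (G := G) B ↔
      ∀ u v w : E, B.form (adL E G u v) w + B.form v (adL E G u w) = 0 := by
  have h (u v w : GroupLieAlgebra 𝓘(ℝ, E) G) :
      B.form (adL E G u v : E) (w : E) + B.form (v : E) (adL E G u w : E) =
        B.form (⁅u, v⁆ : GroupLieAlgebra 𝓘(ℝ, E) G) w +
          B.form v (⁅u, w⁆ : GroupLieAlgebra 𝓘(ℝ, E) G) :=
    congrArg₂ (fun x y : E => B.form x w + B.form v y) (adL_apply (G := G) u v)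
      (adL_apply (G := G) u w)
  exact ⟨fun hB u v w => (h u v w).trans (hB u v w), fun hB u v w => (h u v w).symm.trans (hB u v w)⟩

variable [FiniteDimensional ℝ E]

/-- The property `form_adStar` that defines `ad*`, read in the model space. -/
lemma form_adStar_model (g : InnerProd E) (u v w : E) :
    g.form (adStar (E := E) (G := G) g u v : E) w = g.form v (adL E G u w) :=
  (form_adStar (E := E) (G := G) g u v w).trans
    (congrArg (fun x : E => g.form v x) (adL_apply (G := G) u w).symm)

variable {B : InnerProd E} {W : Submodule ℝ E} {δ : ℝ} {hδ : -1 < δ}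

lemma proj_adL (hB : IsBiInvariant (E := E) (G := G) B)
    (hW : ∀ u ∈ W, ∀ v ∈ W, adL E G u v ∈ W) {p : E} (hp : p ∈ W) (x : E) :
    B.proj W (adL E G p x) = adL E G p (B.proj W x) :=
  B.proj_bracket (br := fun u => (adL E G u : E →L[ℝ] E).toLinearMap)
    (isBiInvariant_iff_adL.1 hB) hW hp x

/-- For the deformed metric, `ad*_u u = δ [P u, u]`. -/
lemma adStar_cheeger_self (hB : IsBiInvariant (E := E) (G := G) B)
    (hW : ∀ u ∈ W, ∀ v ∈ W, adL E G u v ∈ W) (u : E) :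
    @Eq E (adStar (E := E) (G := G) (B.cheeger W δ hδ) u u) (δ • adL E G (B.proj W u) u) := by
  refine (B.cheeger W δ hδ).ext_left fun w => ?_
  rw [form_adStar_model]
  exact (B.cheeger_form_bracket (br := fun u => (adL E G u : E →L[ℝ] E).toLinearMap)
    (isBiInvariant_iff_adL.1 hB) adL_antisymm adL_self hW hδ u w).symm

variable [T2Space G]

lemma lieExp_smul_neg (v : E) (t : ℝ) :
    lieExp (G := G) (t • (-v) : E) = (lieExp (G := G) (t • v : E))⁻¹ := by
  refine lieExp_smul_eq (a := fun t : ℝ => (lieExp (G := G) (t • v : E))⁻¹) (fun s => ?_) ?_ t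
  · simpa only [Ad_lieExp_self] using (hasLeftVelocity_lieExp (G := G) v s).inv
  · rw [lieExp_zero_smul, inv_one]

/-- The solutions of the linear equation `x' = [q, x]`. -/
lemma eq_Ad_lieExp_of_hasDerivAt {q : E} {x : ℝ → E} (hx : ∀ t, HasDerivAt x (adL E G q (x t)) t)
    (t : ℝ) : x t = Ad E (lieExp (G := G) (t • q : E)) (x 0) := by
  -- The integrating factor `Ad (exp (-s q))` turns the equation into a vanishing derivative.
  have h : ∀ s, HasDerivAt (fun s => Ad E (lieExp (G := G) (s • (-q) : E)) (x s)) 0 s := fun s => by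
    have h1 := (hasLeftVelocity_lieExp (G := G) (-q) s).hasDerivAt_Ad.clm_apply (hx s)
    refine h1.congr_deriv ?_
    simp
  have h2 := is_const_of_deriv_eq_zero (fun s => (h s).differentiableAt) (fun s => (h s).deriv) t 0
  simp only [lieExp_smul_neg, lieExp_zero_smul, inv_one, Ad_one_apply] at h2
  rw [← h2, Ad_Ad_inv]

lemma InnerProd.hasDerivAt_proj (B : InnerProd E) (W : Submodule ℝ E) {u : ℝ → E} {u' : E} {t : ℝ}
    (h : HasDerivAt u u' t) : HasDerivAt (fun s => B.proj W (u s)) (B.proj W u') t :=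
  (LinearMap.toContinuousLinearMap (B.proj W)).hasFDerivAt.comp_hasDerivAt t h

/-- The adjoint action of the subgroup commutes with the orthogonal projection. -/
lemma proj_Ad_lieExp (hB : IsBiInvariant (E := E) (G := G) B)
    (hW : ∀ u ∈ W, ∀ v ∈ W, adL E G u v ∈ W) {p : E} (hp : p ∈ W) (x : E) (t : ℝ) :
    B.proj W (Ad E (lieExp (G := G) (t • p : E)) x) =
      Ad E (lieExp (G := G) (t • p : E)) (B.proj W x) := by
  have h : ∀ s, HasDerivAt (fun s => B.proj W (Ad E (lieExp (G := G) (s • p : E)) x))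
      (adL E G p (B.proj W (Ad E (lieExp (G := G) (s • p : E)) x))) s := fun s => by
    rw [← proj_adL hB hW hp]
    exact B.hasDerivAt_proj W (hasDerivAt_Ad_lieExp' (G := G) p x s)
  have h2 := eq_Ad_lieExp_of_hasDerivAt h t
  simpa only [lieExp_zero_smul, Ad_one_apply] using h2

lemma Ad_lieExp_smul_smul_self (p : E) (c t : ℝ) :
    Ad E (lieExp (G := G) (t • (c • p) : E)) p = p := by
  rw [smul_smul]
  exact Ad_lieExp_self p (t * c)

/-- The Euler-Arnold equation `u' = δ [P u, u]` keeps `P u` constant, hence is solved by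
`u(t) = Ad (exp (t δ P u₀)) u₀`. -/
lemma IsEulerArnoldSolution.eq_Ad (hB : IsBiInvariant (E := E) (G := G) B)
    (hW : ∀ u ∈ W, ∀ v ∈ W, adL E G u v ∈ W) {γ : ℝ → G} {u : ℝ → E}
    (h : IsEulerArnoldSolution (B.cheeger W δ hδ) γ u) (t : ℝ) :
    u t = Ad E (lieExp (G := G) (t • (δ • B.proj W (u 0)) : E)) (u 0) := by
  have hu : ∀ s, HasDerivAt u (δ • adL E G (B.proj W (u s)) (u s)) s := fun s =>
    HasDerivAt.congr_deriv (f := u) (h.euler s) (adStar_cheeger_self hB hW (u s))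
  have hP : ∀ s, HasDerivAt (fun s => B.proj W (u s)) 0 s := fun s => by
    refine (B.hasDerivAt_proj W (hu s)).congr_deriv ?_
    rw [map_smul, proj_adL hB hW (B.proj_mem W (u s)), adL_self, smul_zero]
  have hconst : ∀ s, B.proj W (u s) = B.proj W (u 0) := fun s =>
    is_const_of_deriv_eq_zero (fun s => (hP s).differentiableAt) (fun s => (hP s).deriv) s 0
  refine eq_Ad_lieExp_of_hasDerivAt (G := G) (fun s => (hu s).congr_deriv ?_) t
  rw [hconst, map_smul]
  rfl

/-- The curve `t ↦ exp (t Λ w) exp (t δ P w)⁻¹`, which is the geodesic of the deformed metric with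
initial velocity `w`; here `exp` is the exponential map of the Lie group. -/
def cheegerGeodesic (B : InnerProd E) (W : Submodule ℝ E) (δ : ℝ) (w : E) (t : ℝ) : G :=
  lieExp (G := G) (t • B.lam W δ w : E) * (lieExp (G := G) (t • (δ • B.proj W w) : E))⁻¹

lemma cheegerGeodesic_zero (w : E) : cheegerGeodesic (G := G) B W δ w 0 = 1 := by
  rw [cheegerGeodesic, lieExp_zero_smul, lieExp_zero_smul, inv_one, mul_one]

lemma hasLeftVelocity_cheegerGeodesic (w : E) (t : ℝ) :
    HasLeftVelocity (cheegerGeodesic (G := G) B W δ w)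
      (Ad E (lieExp (G := G) (t • (δ • B.proj W w) : E)) w) t := by
  have h := (hasLeftVelocity_lieExp (G := G) (B.lam W δ w) t).mul
    (hasLeftVelocity_lieExp (G := G) (δ • B.proj W w) t).inv
  have h2 : Ad E (lieExp (G := G) (t • (δ • B.proj W w) : E)) (B.lam W δ w) +
      -Ad E (lieExp (G := G) (t • (δ • B.proj W w) : E)) (δ • B.proj W w) =
        Ad E (lieExp (G := G) (t • (δ • B.proj W w) : E)) w := by
    rw [B.lam_apply, map_add, add_neg_cancel_right]
  rw [inv_inv, h2] at h
  exact h

lemma isEulerArnoldSolution_cheegerGeodesic (hB : IsBiInvariant (E := E) (G := G) B)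
    (hW : ∀ u ∈ W, ∀ v ∈ W, adL E G u v ∈ W) (w : E) :
    IsEulerArnoldSolution (E := E) (B.cheeger W δ hδ) (cheegerGeodesic (G := G) B W δ w)
      (fun t => Ad E (lieExp (G := G) (t • (δ • B.proj W w) : E)) w) := by
  refine ⟨fun t => hasLeftVelocity_cheegerGeodesic w t, fun t => ?_⟩
  refine HasDerivAt.congr_deriv (F := E) (hasDerivAt_Ad_lieExp' (G := G) (δ • B.proj W w) w t) ?_
  refine Eq.trans ?_ (adStar_cheeger_self hB hW _).symm
  rw [proj_Ad_lieExp hB hW (W.smul_mem δ (B.proj_mem W w)), Ad_lieExp_smul_smul_self, map_smul]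
  rfl

lemma IsEulerArnoldSolution.eq_cheegerGeodesic (hB : IsBiInvariant (E := E) (G := G) B)
    (hW : ∀ u ∈ W, ∀ v ∈ W, adL E G u v ∈ W) {γ : ℝ → G} {u : ℝ → E}
    (h : IsEulerArnoldSolution (B.cheeger W δ hδ) γ u) (h0 : γ 0 = 1) :
    γ = cheegerGeodesic B W δ (u 0) := by
  refine eq_of_hasLeftVelocity (E := E) (G := G) (u := u) h.flow (fun t => ?_) ?_
  · rw [h.eq_Ad hB hW t]
    exact hasLeftVelocity_cheegerGeodesic (u 0) t
  · rw [h0, cheegerGeodesic_zero]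

lemma riemannianExp_cheeger (hB : IsBiInvariant (E := E) (G := G) B)
    (hW : ∀ u ∈ W, ∀ v ∈ W, adL E G u v ∈ W) (w : E) :
    riemannianExp (E := E) (B.cheeger W δ hδ) w = cheegerGeodesic (G := G) B W δ w 1 := by
  have hex : ∃ (γ : ℝ → G) (u : ℝ → GroupLieAlgebra 𝓘(ℝ, E) G),
      IsEulerArnoldSolution (E := E) (B.cheeger W δ hδ) γ u ∧ γ 0 = 1 ∧ u 0 = w :=
    ⟨_, _, isEulerArnoldSolution_cheegerGeodesic hB hW w, cheegerGeodesic_zero w, by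
      simp only [lieExp_zero_smul, Ad_one_apply]
      rfl⟩
  rw [show riemannianExp (E := E) (G := G) (B.cheeger W δ hδ) w = hex.choose 1 from dif_pos hex]
  obtain ⟨u, hu, h0, hu0⟩ := hex.choose_spec
  rw [IsEulerArnoldSolution.eq_cheegerGeodesic (E := E) hB hW hu h0]
  exact congrArg (fun w : E => cheegerGeodesic (G := G) B W δ w 1) hu0

end EulerArnold

/-! ### Variational geodesics solve the Euler-Arnold equation -/

/-- Differentiation under the integral sign over a compact interval. -/
lemma hasDerivAt_intervalIntegral_of_contDiff {F : ℝ × ℝ → ℝ} (hF : ContDiff ℝ ∞ F)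
    {F' : ℝ → ℝ} (hF' : ∀ t, HasDerivAt (fun s => F (s, t)) (F' t) 0) (a b : ℝ) :
    HasDerivAt (fun s => ∫ t in a..b, F (s, t)) (∫ t in a..b, F' t) 0 := by
  have hd : ∀ s t, HasDerivAt (fun s => F (s, t)) (fderiv ℝ F (s, t) (1, 0)) s := fun s t => by
    have h1 : HasFDerivAt F (fderiv ℝ F (s, t)) (s, t) :=
      (hF.differentiable (by simp) (s, t)).hasFDerivAt
    exact h1.comp_hasDerivAt s ((hasDerivAt_id s).prodMk (hasDerivAt_const s t))
  have hc : Continuous fun p : ℝ × ℝ => fderiv ℝ F p (1, 0) :=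
    (hF.continuous_fderiv (by simp)).clm_apply continuous_const
  obtain ⟨C, hC⟩ := ((isCompact_closedBall (0 : ℝ) 1).prod
    (isCompact_uIcc (a := a) (b := b))).exists_bound_of_continuousOn hc.continuousOn
  have h := (intervalIntegral.hasDerivAt_integral_of_dominated_loc_of_deriv_le
    (μ := MeasureTheory.volume) (F := fun s t => F (s, t))
    (F' := fun s t => fderiv ℝ F (s, t) (1, 0)) (bound := fun _ => C) (a := a) (b := b)
    (Metric.closedBall_mem_nhds (0 : ℝ) one_pos)
    (Eventually.of_forall fun s => (hF.continuous.comp (by fun_prop)).aestronglyMeasurable)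
    ((hF.continuous.comp (by fun_prop)).intervalIntegrable a b)
    ((hc.comp (f := fun t : ℝ => ((0 : ℝ), t)) (by fun_prop)).aestronglyMeasurable)
    (Eventually.of_forall fun t ht s hs => hC (s, t) ⟨hs, Set.uIoc_subset_uIcc ht⟩)
    intervalIntegrable_const
    (Eventually.of_forall fun t _ s _ => hd s t)).2
  simpa only [fun t => (hd 0 t).unique (hF' t)] using h

section Geodesic

variable {E : Type*} [NormedAddCommGroup E] [NormedSpace ℝ E]
  {G : Type*} [TopologicalSpace G] [ChartedSpace E G] [Group G]
  [LieGroup 𝓘(ℝ, E) ∞ G]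

lemma exists_contDiff_leftVelocity {γ : ℝ → G} (hγ : ContMDiff 𝓘(ℝ, ℝ) 𝓘(ℝ, E) ∞ γ) :
    ∃ u : ℝ → E, ContDiff ℝ ∞ u ∧ ∀ t, HasLeftVelocity γ (u t) t := by
  have hv : ∀ t, ∃ u : E, HasLeftVelocity γ u t := fun t =>
    exists_hasLeftVelocity (hγ.mdifferentiable (by simp) t)
  choose u hu using hv
  refine ⟨u, ?_, hu⟩
  have hL : ∀ t, HasMFDerivAt 𝓘(ℝ, ℝ) 𝓘(ℝ, E) (fun s => (γ t)⁻¹ * γ s) t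
      ((1 : ℝ →L[ℝ] ℝ).smulRight (u t) : ℝ →L[ℝ] E) := fun t => by
    have h := (hu t).mul_left (γ t)⁻¹
    rw [HasLeftVelocity, inv_mul_cancel, dL_one] at h
    exact h
  have h1 : ContMDiff 𝓘(ℝ, ℝ) 𝓘(ℝ, ℝ →L[ℝ] E) ∞
      (fun t => ((1 : ℝ →L[ℝ] ℝ).smulRight (u t) : ℝ →L[ℝ] E)) := fun t =>
    contMDiffAt_mfderiv_of_apply_eq_one (f := fun t s => (γ t)⁻¹ * γ s) (g := fun t => t)
      (((hγ.comp contMDiff_fst).inv.mul (hγ.comp contMDiff_snd)) _) contMDiffAt_id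
      (fun t => inv_mul_cancel _) hL
  have h2 := h1.contDiff.clm_apply (contDiff_const (c := (1 : ℝ)))
  simpa using h2

variable [FiniteDimensional ℝ E] [T2Space G] {g : InnerProd E} {γ : ℝ → G}

/-- The first variation of the energy, for the variation `γ(t) exp (s f(t) v)`. -/
lemma IsGeodesic.integral_eq_zero (h : IsGeodesic (E := E) g γ) {u : ℝ → E}
    (hu : ContDiff ℝ ∞ u) (hγu : ∀ t, HasLeftVelocity γ (u t) t) {f : ℝ → ℝ}
    (hf : ContDiff ℝ ∞ f) {a b : ℝ} (hab : a < b) (hfa : f a = 0) (hfb : f b = 0) (v : E) :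
    ∫ t in a..b, (f t * g.form (u t) (adL E G (u t) v) + deriv f t * g.form (u t) v) = 0 := by
  let Γ : ℝ → ℝ → G := fun s t => γ t * lieExp (G := G) ((s * f t) • v : E)
  let A : ℝ → E →L[ℝ] E := fun σ => Ad E (lieExp (G := G) (σ • (-v) : E))
  let U : ℝ × ℝ → E := fun p => A (p.1 * f p.2) (u p.2) + (p.1 * deriv f p.2) • v
  have hf1 : ∀ t, HasDerivAt f (deriv f t) t := fun t =>
    (hf.differentiable (by simp) t).hasDerivAt
  have hf' : ContDiff ℝ ∞ (deriv f) := (contDiff_infty_iff_deriv.1 hf).2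
  have hΓ : ∀ s t, HasLeftVelocity (Γ s) (U (s, t)) t := fun s t => by
    have h1 := (hγu t).mul (HasLeftVelocity.comp (f := fun t => s * f t)
      (hasLeftVelocity_lieExp (G := G) v (s * f t)) ((hf1 t).const_mul s))
    rwa [← lieExp_smul_neg] at h1
  have hA : ContDiff ℝ ∞ A := ContMDiff.contDiff (contMDiff_Ad.comp (contMDiff_lieExp_smul (-v)))
  have hU : ContDiff ℝ ∞ U := by
    refine ContDiff.add (ContDiff.clm_apply (hA.comp ?_) (hu.comp contDiff_snd)) ?_
    · exact contDiff_fst.mul (hf.comp contDiff_snd)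
    · exact (contDiff_fst.mul (hf'.comp contDiff_snd)).smul contDiff_const
  let Gc : E →L[ℝ] E →L[ℝ] ℝ := g.form.toContinuousBilinearMap
  have hQ : ContDiff ℝ ∞ fun p => Gc (U p) (U p) :=
    (Gc.contDiff.comp hU).clm_apply hU
  have hU0 : ∀ t, U (0, t) = u t := fun t => by
    show A (0 * f t) (u t) + (0 * deriv f t) • v = u t
    rw [zero_mul, zero_mul, zero_smul, add_zero]
    show Ad E (lieExp (G := G) ((0 : ℝ) • (-v) : E)) (u t) = u t
    rw [lieExp_zero_smul, Ad_one_apply]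
  have hdU : ∀ t, HasDerivAt (fun s => U (s, t)) (f t • adL E G (u t) v + deriv f t • v) 0 :=
    fun t => by
    have h1 : HasDerivAt (fun σ => A σ (u t)) (adL E G (-v) (u t)) (0 * f t) := by
      have := hasDerivAt_Ad_lieExp (G := G) (-v) (u t) (0 * f t)
      rw [zero_mul, lieExp_zero_smul, Ad_one_apply] at this
      rw [zero_mul]
      exact this
    have h2 := (HasDerivAt.scomp (h := fun s : ℝ => s * f t) 0 h1
      ((hasDerivAt_id (0 : ℝ)).mul_const (f t))).add
        (((hasDerivAt_id (0 : ℝ)).mul_const (deriv f t)).smul_const v)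
    refine h2.congr_deriv ?_
    rw [map_neg, neg_apply, adL_antisymm v, neg_neg, one_mul, one_mul]
  have hdQ : ∀ t, HasDerivAt (fun s => Gc (U (s, t)) (U (s, t)))
      (2 * (f t * g.form (u t) (adL E G (u t) v) + deriv f t * g.form (u t) v)) 0 := fun t => by
    refine ((Gc.hasFDerivAt.comp_hasDerivAt (0 : ℝ) (hdU t)).clm_apply (hdU t)).congr_deriv ?_
    rw [Function.comp_apply, hU0]
    show g.form _ (u t) + g.form (u t) _ = _
    rw [g.symm _ (u t), map_add, map_smul, map_smul, smul_eq_mul, smul_eq_mul]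
    ring
  have hsmooth : ContMDiff 𝓘(ℝ, ℝ × ℝ) 𝓘(ℝ, E) ∞ (fun p : ℝ × ℝ => Γ p.1 p.2) := by
    refine (h.smooth.comp contDiff_snd.contMDiff).mul ?_
    exact (contMDiff_lieExp_smul v).comp (contDiff_fst.mul (hf.comp contDiff_snd)).contMDiff
  have hcrit := h.critical a b hab Γ hsmooth
    (fun t => by simp only [Γ, zero_mul, lieExp_zero_smul, mul_one])
    (fun s => by simp only [Γ, hfa, mul_zero, lieExp_zero_smul, mul_one])
    (fun s => by simp only [Γ, hfb, mul_zero, lieExp_zero_smul, mul_one])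
  have henergy : ∀ s, energy (E := E) g a b (Γ s) =
      (1 / 2) * ∫ t in a..b, Gc (U (s, t)) (U (s, t)) := fun s => by
    refine congrArg (fun x : ℝ => (1 / 2) * x) (intervalIntegral.integral_congr fun t _ => ?_)
    exact congrArg (fun x : E => g.form x x) (hΓ s t).leftTranslate_velocity
  simp only [henergy] at hcrit
  have h3 := hcrit.unique ((hasDerivAt_intervalIntegral_of_contDiff hQ hdQ a b).const_mul (1 / 2))
  rw [intervalIntegral.integral_const_mul] at h3
  linarith

/-- Geodesics in the variational sense solve the Euler-Arnold equation: integrate the term with `f'`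
in the first variation by parts and choose `f` so that the integrand becomes nonnegative. -/
lemma IsGeodesic.exists_isEulerArnoldSolution (h : IsGeodesic (E := E) g γ) :
    ∃ u : ℝ → E, IsEulerArnoldSolution (E := E) g γ u := by
  obtain ⟨u, hu, hγu⟩ := exists_contDiff_leftVelocity h.smooth
  refine ⟨u, hγu, fun t₀ => ?_⟩
  have hud : ∀ t, HasDerivAt u (deriv u t) t := fun t =>
    (hu.differentiable (by simp) t).hasDerivAt
  have hu' : ContDiff ℝ ∞ (deriv u) := (contDiff_infty_iff_deriv.1 hu).2
  refine HasDerivAt.congr_deriv (F := E) (hud t₀) ?_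
  refine g.ext_left fun v => ?_
  rw [form_adStar_model]
  let Gc : E →L[ℝ] E →L[ℝ] ℝ := g.form.toContinuousBilinearMap
  let w : ℝ → ℝ := fun t => Gc (u t) (adL E G (u t) v) - Gc (deriv u t) v
  have hw : ContDiff ℝ ∞ w :=
    ((Gc.contDiff.comp hu).clm_apply (((adL E G).contDiff.comp hu).clm_apply contDiff_const)).sub
      ((Gc.contDiff.comp hu').clm_apply contDiff_const)
  -- The test function is a bump at `t₀` times the quantity that has to vanish.
  let f : ℝ → ℝ := fun t => (1 - (t - t₀) ^ 2) * w t
  have hf : ContDiff ℝ ∞ f := ContDiff.mul (by fun_prop) hw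
  have hfa : f (t₀ - 1) = 0 := by simp [f]
  have hfb : f (t₀ + 1) = 0 := by simp [f]
  have hf1 : ∀ t, HasDerivAt f (deriv f t) t := fun t =>
    (hf.differentiable (by simp) t).hasDerivAt
  have hf' : ContDiff ℝ ∞ (deriv f) := (contDiff_infty_iff_deriv.1 hf).2
  have hab : t₀ - 1 < t₀ + 1 := by linarith
  have h1 := h.integral_eq_zero hu hγu hf hab hfa hfb v
  -- The integral of the derivative of `f g(u, v)` vanishes, since `f` does at both ends.
  have hb : ∀ t, HasDerivAt (fun t => f t * Gc (u t) v)
      (deriv f t * Gc (u t) v + f t * Gc (deriv u t) v) t := fun t => by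
    have h2 : HasDerivAt (fun t => Gc (u t) v) (Gc (deriv u t) v) t :=
      ((Gc.hasFDerivAt.comp_hasDerivAt t (hud t)).clm_apply (hasDerivAt_const t v)).congr_deriv
        (by simp)
    exact (hf1 t).mul h2
  have hbc : Continuous fun t => deriv f t * Gc (u t) v + f t * Gc (deriv u t) v :=
    ((hf'.mul ((Gc.contDiff.comp hu).clm_apply contDiff_const)).add
      (hf.mul ((Gc.contDiff.comp hu').clm_apply contDiff_const))).continuous
  have h2 := intervalIntegral.integral_eq_sub_of_hasDerivAt (a := t₀ - 1) (b := t₀ + 1)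
    (fun t _ => hb t) (hbc.intervalIntegrable _ _)
  rw [hfa, hfb, zero_mul, zero_mul, sub_zero] at h2
  have hac : Continuous fun t => f t * Gc (u t) (adL E G (u t) v) + deriv f t * Gc (u t) v :=
    ((hf.mul ((Gc.contDiff.comp hu).clm_apply
      (((adL E G).contDiff.comp hu).clm_apply contDiff_const))).add
        (hf'.mul ((Gc.contDiff.comp hu).clm_apply contDiff_const))).continuous
  have h3 : ∫ t in (t₀ - 1)..(t₀ + 1), (1 - (t - t₀) ^ 2) * w t ^ 2 = 0 := by
    have h4 := intervalIntegral.integral_sub (hac.intervalIntegrable (t₀ - 1) (t₀ + 1))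
      (hbc.intervalIntegrable (t₀ - 1) (t₀ + 1)) (μ := MeasureTheory.volume)
    rw [h2, sub_zero] at h4
    refine Eq.trans (intervalIntegral.integral_congr fun t _ => ?_) (h4.trans h1)
    simp only [f, w]
    ring
  have hw0 : w t₀ = 0 := by
    by_contra hne
    refine (intervalIntegral.integral_pos hab (f := fun t => (1 - (t - t₀) ^ 2) * w t ^ 2)
      (Continuous.continuousOn ?_) (fun t ht => ?_) ⟨t₀, ⟨by linarith, by linarith⟩, ?_⟩).ne' h3
    · exact (by fun_prop : Continuous fun t : ℝ => 1 - (t - t₀) ^ 2).mul (hw.continuous.pow 2)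
    · exact mul_nonneg (by nlinarith [ht.1, ht.2]) (sq_nonneg _)
    · simpa using sq_pos_of_ne_zero hne
  exact (sub_eq_zero.1 hw0).symm

end Geodesic

/-! ### Conjugate points -/

section Conjugate

variable {E : Type*} [NormedAddCommGroup E] [NormedSpace ℝ E] [FiniteDimensional ℝ E]
  {G : Type*} [TopologicalSpace G] [ChartedSpace E G] [Group G]

variable {B : InnerProd E} {W : Submodule ℝ E} {δ : ℝ} {hδ : -1 < δ}

lemma cheegerGeodesic_one (w : E) : cheegerGeodesic (G := G) B W δ w 1 =
    lieExp (G := G) (B.lam W δ w : E) * (lieExp (G := G) (δ • B.proj W w : E))⁻¹ := by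
  rw [cheegerGeodesic, lieExp_one_smul, lieExp_one_smul]

lemma cheegerGeodesic_smul (w : E) (t : ℝ) :
    cheegerGeodesic (G := G) B W δ (t • w) 1 = cheegerGeodesic B W δ w t := by
  rw [cheegerGeodesic_one, cheegerGeodesic, map_smul, map_smul, smul_comm]

variable [LieGroup 𝓘(ℝ, E) ∞ G] [T2Space G]

lemma mdifferentiableAt_cheegerGeodesic_one (w : E) :
    MDifferentiableAt 𝓘(ℝ, E) 𝓘(ℝ, E)
      (fun v : E => cheegerGeodesic (G := G) B W δ v 1) w := by
  simp only [cheegerGeodesic_one]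
  have h : ∀ L : E →ₗ[ℝ] E,
      MDifferentiableAt 𝓘(ℝ, E) 𝓘(ℝ, E) (fun v : E => lieExp (G := G) (L v)) w := fun L =>
    MDifferentiableAt.comp (g := fun v : E => lieExp (G := G) v) w (mdifferentiableAt_lieExp (L w))
      (LinearMap.toContinuousLinearMap L).differentiableAt.mdifferentiableAt
  have hm : MDifferentiableAt (𝓘(ℝ, E).prod 𝓘(ℝ, E)) 𝓘(ℝ, E) (fun p : G × G => p.1 * p.2⁻¹)
      (lieExp (G := G) (B.lam W δ w), lieExp (G := G) ((δ • B.proj W) w)) :=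
    (contMDiff_fst.mul (contMDiff_snd (n := ∞)).inv).mdifferentiableAt (by simp)
  exact hm.comp w ((h (B.lam W δ)).prodMk (h (δ • B.proj W)))

/-- The Riemannian exponential map is constant on the curve `w_s = Ad (exp (s p)) w` if
`exp (Λ w) = 1` and `Ad (exp (s p))` fixes `P w`: then `P w_s = P w`, and `exp (Λ w_s)` is conjugate
to `exp (Λ w) = 1`. -/
lemma cheegerGeodesic_Ad_lieExp (hB : IsBiInvariant (E := E) (G := G) B)
    (hW : ∀ u ∈ W, ∀ v ∈ W, adL E G u v ∈ W) {w : E}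
    (hw : lieExp (G := G) (B.lam W δ w : E) = 1) {p : E} (hp : p ∈ W)
    (hpw : ∀ s : ℝ, Ad E (lieExp (G := G) (s • p : E)) (B.proj W w) = B.proj W w) (s : ℝ) :
    cheegerGeodesic (G := G) B W δ (Ad E (lieExp (G := G) (s • p : E)) w) 1 =
      cheegerGeodesic B W δ w 1 := by
  have h1 : B.proj W (Ad E (lieExp (G := G) (s • p : E)) w) = B.proj W w := by
    rw [proj_Ad_lieExp hB hW hp, hpw]
  have h2 : B.lam W δ (Ad E (lieExp (G := G) (s • p : E)) w) =
      Ad E (lieExp (G := G) (s • p : E)) (B.lam W δ w) := by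
    rw [B.lam_apply, B.lam_apply, h1, map_add, map_smul, hpw]
  rw [cheegerGeodesic_one, cheegerGeodesic_one, h1, h2, lieExp_Ad, hw, mul_one, mul_inv_cancel]

/-- The singular direction is the velocity `τ [P u, u]` at `s = 0` of a curve that the Riemannian
exponential map contracts to a point. -/
lemma apply_adL_proj_eq_zero_of_hasMFDerivAt (hB : IsBiInvariant (E := E) (G := G) B)
    (hW : ∀ u ∈ W, ∀ v ∈ W, adL E G u v ∈ W) {u : E} {τ : ℝ}
    (hτ : lieExp (G := G) (B.lam W δ (τ • u) : E) = 1) {D : E →L[ℝ] E}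
    (hD : HasMFDerivAt 𝓘(ℝ, E) 𝓘(ℝ, E)
      (fun v : E => cheegerGeodesic (G := G) B W δ v 1) (τ • u) D) :
    D (τ • adL E G (B.proj W u) u) = 0 := by
  let c : ℝ → E := fun s => Ad E (lieExp (G := G) (s • B.proj W u : E)) (τ • u)
  have hc0 : c 0 = τ • u := by
    show Ad E (lieExp (G := G) ((0 : ℝ) • B.proj W u : E)) (τ • u) = _
    rw [lieExp_zero_smul, Ad_one_apply]
  have hc : HasDerivAt c (τ • adL E G (B.proj W u) u) 0 := by
    have h := hasDerivAt_Ad_lieExp' (G := G) (B.proj W u) (τ • u) 0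
    rwa [lieExp_zero_smul, Ad_one_apply, map_smul] at h
  have h1 : HasMFDerivAt 𝓘(ℝ, E) 𝓘(ℝ, E)
      (fun v : E => cheegerGeodesic (G := G) B W δ v 1) (c 0) D := by rwa [hc0]
  have h2 := HasMFDerivAt.comp (0 : ℝ) h1 hc.hasFDerivAt.hasMFDerivAt
  have h3 : (fun v : E => cheegerGeodesic (G := G) B W δ v 1) ∘ c =
      fun _ => cheegerGeodesic (G := G) B W δ (τ • u) 1 := by
    ext s
    refine cheegerGeodesic_Ad_lieExp hB hW hτ (B.proj_mem W u) (fun s => ?_) s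
    rw [map_smul, map_smul, Ad_lieExp_self]
  rw [h3] at h2
  have h4 := congrArg (fun L : ℝ →L[ℝ] E => L 1) (hasMFDerivAt_unique h2 (hasMFDerivAt_const _ _))
  have h5 : D ((1 : ℝ) • (τ • adL E G (B.proj W u) u)) = 0 := h4
  rwa [one_smul] at h5

/-- The conjugacy for the deformation along an arbitrary subalgebra `W` of the Lie algebra. -/
lemma isConjugateAlong_cheeger (hB : IsBiInvariant (E := E) (G := G) B)
    (hW : ∀ u ∈ W, ∀ v ∈ W, adL E G u v ∈ W) {γ : ℝ → G}
    (hγ : IsGeodesic (E := E) (B.cheeger W δ hδ) γ) (hγ0 : γ 0 = 1) {u₀ : E}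
    (hu₀ : HasLeftVelocity γ u₀ 0)
    (hns : (adStar (E := E) (G := G) (B.cheeger W δ hδ) u₀ u₀ : E) ≠ 0) {τ : ℝ} (hτ : 0 < τ)
    (hclosed : lieExp (G := G) (τ • B.lam W δ u₀ : E) = 1) :
    IsConjugateAlong (E := E) (B.cheeger W δ hδ) γ u₀ τ := by
  obtain ⟨u, hu⟩ := hγ.exists_isEulerArnoldSolution
  have h0 : u 0 = u₀ := HasLeftVelocity.unique (hu.flow 0) hu₀
  have hγe := hu.eq_cheegerGeodesic hB hW hγ0
  rw [h0] at hγe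
  have hexp : (fun v : E => riemannianExp (E := E) (G := G) (B.cheeger W δ hδ) v) =
      fun v : E => cheegerGeodesic (G := G) B W δ v 1 := funext (riemannianExp_cheeger hB hW)
  have hne : δ • adL E G (B.proj W u₀) u₀ ≠ 0 := fun h =>
    hns ((adStar_cheeger_self hB hW u₀).trans h)
  refine ⟨?_, ?_⟩
  · rw [hγe, ← cheegerGeodesic_smul]
    exact (congrFun hexp (τ • u₀)).symm
  · obtain ⟨D, hD⟩ : ∃ D : E →L[ℝ] E, HasMFDerivAt 𝓘(ℝ, E) 𝓘(ℝ, E)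
        (fun v : E => cheegerGeodesic (G := G) B W δ v 1) (τ • u₀) D :=
      ⟨_, (mdifferentiableAt_cheegerGeodesic_one (τ • u₀)).hasMFDerivAt⟩
    have hD0 := apply_adL_proj_eq_zero_of_hasMFDerivAt hB hW (by rwa [map_smul]) hD
    rw [← hexp] at hD
    refine ⟨D, hD, fun hinj => ?_⟩
    have h1 : τ • adL E G (B.proj W u₀) u₀ = 0 := hinj (hD0.trans (map_zero D).symm)
    exact hne (smul_eq_zero_of_right δ ((smul_eq_zero.1 h1).resolve_left hτ.ne'))

end Conjugate

end

end BergerCheeger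

theorem mainTheorem9
    {E : Type*} [NormedAddCommGroup E] [NormedSpace ℝ E] [FiniteDimensional ℝ E]
    {G : Type*} [TopologicalSpace G] [T2Space G] [ChartedSpace E G] [Group G]
    [LieGroup 𝓘(ℝ, E) ∞ G]
    {F : Type*} [NormedAddCommGroup F] [NormedSpace ℝ F] [FiniteDimensional ℝ F]
    {K : Type*} [TopologicalSpace K] [ChartedSpace F K] [Group K] [LieGroup 𝓘(ℝ, F) ∞ K]
    (ι : K →* G) (hι : BergerCheeger.IsLieSubgroup E F ι)
    (B : BergerCheeger.InnerProd (GroupLieAlgebra 𝓘(ℝ, E) G))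
    (hB : BergerCheeger.IsBiInvariant B)
    (δ : ℝ) (hδ : -1 < δ)
    (g : BergerCheeger.InnerProd (GroupLieAlgebra 𝓘(ℝ, E) G))
    (hg : g = B.cheeger (BergerCheeger.subgroupLieAlgebra E F ι) δ hδ)
    (γ : ℝ → G) (hγ : BergerCheeger.IsGeodesic g γ) (hγ0 : γ 0 = 1)
    (u₀ : GroupLieAlgebra 𝓘(ℝ, E) G)
    (hu₀ : BergerCheeger.leftTranslate (γ 0) (BergerCheeger.velocity γ 0) = u₀)
    (hnonsteady : BergerCheeger.adStar g u₀ u₀ ≠ 0)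
    (τ : ℝ) (hτ : 0 < τ)
    (hclosed : BergerCheeger.lieExp
      (τ • B.lam (BergerCheeger.subgroupLieAlgebra E F ι) δ u₀) = 1) :
    BergerCheeger.IsConjugateAlong g γ u₀ τ := by
  subst hg
  have hu : BergerCheeger.HasLeftVelocity (E := E) γ u₀ 0 := by
    obtain ⟨v, hv⟩ := BergerCheeger.exists_hasLeftVelocity (E := E) (t := 0)
      (hγ.smooth.mdifferentiable (by simp) 0)
    have h : v = u₀ := hv.leftTranslate_velocity.symm.trans hu₀
    rwa [h] at hv
  exact BergerCheeger.isConjugateAlong_cheeger hB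
    (fun p hp q hq => BergerCheeger.adL_mem_subgroupLieAlgebra hι p q hp hq)
    hγ hγ0 hu hnonsteady hτ hclosed
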